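/- \textbf{Conventions.} All spaces are pointed, $[\,\cdot\,,\cdot\,]$ denotes pointed homotopy classes of pointed maps, products and smash products are formed with the compactly generated topology, $\Sigma$ is the reduced suspension, and $[\Sigma W,X]$ carries the group structure given by the suspension comultiplication $\nu:\Sigma W\to\Sigma W\vee\Sigma W$, here written multiplicatively; $(x,y)=xyx^{-1}y^{-1}$ and $x^{y}=yxy^{-1}$. $\Sigma W$ is homotopy co-commutative if $T\circ\nu\simeq\nu$ for the interchange map $T$. For a space $W$ let $\tau_W(X)=[\Sigma(W\sqcup *),X]$. For $\xi\in[\Sigma A,X]$, $\eta\in[\Sigma B,X]$ the generalized Whitehead product $[\xi,\eta]\in[\Sigma(A\wedge B),X]$ is the class whose pullback along $\Sigma(A\times B)\to\Sigma(A\wedge B)$ is the commutator $\big((\Sigma p_A)^*\xi,(\Sigma p_B)^*\eta\big)$. Let $A\wedge B\wedge C$ be the quotient of $A\times B\times C$ by the fat wedge; an iterated product $[[\xi,\eta],\zeta]$ is regarded as an element of $[\Sigma(A\wedge B\wedge C),X]$ through the natural map $A\wedge B\wedge C\to(A\wedge B)\wedge C$, and it has an image $\overline{[[\xi,\eta],\zeta]}\in\tau_{A\times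 B\times C}(X)$ through $(A\times B\times C)\sqcup *\to A\times B\times C\to A\wedge B\wedge C$. Let $t_{213}(a,b,c)=(b,a,c)$, $t_{321}(a,b,c)=(c,b,a)$, $t_{132}(a,b,c)=(a,c,b)$, $t_{312}(a,b,c)=(c,a,b)$, $t_{231}(a,b,c)=(b,c,a)$, on products, products with a disjoint base point, and smash products. \textbf{Theorem.} Let $A,B,C$ be pointed spaces, each of the pointed homotopy type of a well-pointed compactly generated Hausdorff space, let $X$ be a pointed space, and let $\alpha\in[\Sigma A,X]$, $\beta\in[\Sigma B,X]$, $\gamma\in[\Sigma C,X]$, with images $\bar\alpha,\bar\beta,\bar\gamma\in\tau_{A\times B\times C}(X)$ under the projections of $A\times B\times C$. Then the generalized Whitehead products below, and the action of $\pi_1(X)$ in (3), exist and are unique, and: (1) In $\tau_{A\times B\times C}(X)$, $$\big((\Sigma t_{213})^*\overline{[[\beta^{-1},\alpha],\gamma]}\big)^{\bar\beta}\cdot\big((\Sigma t_{321})^*\overline{[[\gamma^{-1},\beta],\alpha]}\big)^{\bar\gamma}\cdot\big((\Sigma t_{132})^*\overline{[[\alpha^{-1},\gamma],\beta]}\big)^{\bar\alpha}=1,$$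 and the three elements that are conjugated here are the iterated commutators $((\bar\beta^{-1},\bar\alpha),\bar\gamma)$, $((\bar\gamma^{-1},\bar\beta),\bar\alpha)$ and $((\bar\alpha^{-1},\bar\gamma),\bar\beta)$. (2) If $\Sigma A,\Sigma B,\Sigma C$ are homotopy co-commutative, then in $[\Sigma(A\wedge B\wedge C),X]$ $$[[\alpha,\beta],\gamma]\cdot(\Sigma t_{312})^*[[\gamma,\alpha],\beta]\cdot(\Sigma t_{231})^*[[\beta,\gamma],\alpha]=1.$$ (3) If each of $A,B,C$ has a homotopy co-commutative suspension or is $S^0$ (up to pointed homotopy equivalence; so that its suspension is $S^1$), then in $[\Sigma(A\wedge B\wedge C),X]$ $$(\Sigma t_{213})^*\big(\beta\cdot[[\beta^{-1},\alpha],\gamma]\big)\;(\Sigma t_{321})^*\big(\gamma\cdot[[\gamma^{-1},\beta],\alpha]\big)\;(\Sigma t_{132})^*\big(\alpha\cdot[[\alpha^{-1},\gamma],\beta]\big)=1,$$ where, for $\xi\in[\Sigma V,X]$ with $V\in\{A,B,C\}$ and $\eta\in[\Sigma W,X]$, $\xi\cdot\eta=\eta$ if $V\not\simeq S^0$, while if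 $V\simeq S^0$, so that $\xi\in[\Sigma S^0,X]=\pi_1(X)$, $\xi\cdot\eta=\eta^{\xi}$ is the classical action of $\pi_1(X)$ on $[\Sigma W,X]$, i.e. the element of $[\Sigma W,X]$ whose image in $\tau_W(X)\cong[\Sigma W,X]\rtimes\pi_1(X)$ is the conjugate by $\xi$ of the image of $\eta$. -/

import Mathlib

universe u v w

noncomputable section

namespace Jacobi

open Topology unitInterval

/-! Pointed spaces, pointed maps, pointed homotopy classes -/

/-- A pointed topological space. -/
structure PSpace : Type (u + 1) where
  /-- the underlying set -/
  carrier : Type u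
  /-- its topology -/
  top : TopologicalSpace carrier
  /-- the base point -/
  pt : carrier

instance : CoeSort PSpace.{u} (Type u) := ⟨PSpace.carrier⟩

instance (A : PSpace.{u}) : TopologicalSpace A := A.top

/-- A pointed (base point preserving, continuous) map. -/
structure PMap (A : PSpace.{u}) (X : PSpace.{v}) where
  /-- the underlying continuous map -/
  toMap : C(A, X)
  map_pt : toMap A.pt = X.pt

namespace PMap

/-- The identity map. -/
def id (A : PSpace.{u}) : PMap A A := ⟨ContinuousMap.id A, rfl⟩

/-- The constant map at the base point. -/
def const (A : PSpace.{u}) (X : PSpace.{v}) : PMap A X := ⟨ContinuousMap.const A X.pt, rfl⟩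

/-- The composite `g ∘ f`. -/
def comp {A : PSpace.{u}} {B : PSpace.{v}} {X : PSpace.{w}} (g : PMap B X) (f : PMap A B) :
    PMap A X :=
  ⟨g.toMap.comp f.toMap, by simp [f.map_pt, g.map_pt]⟩

/-- Pointed homotopy: homotopy relative to the base point. -/
def Homotopic {A : PSpace.{u}} {X : PSpace.{v}} (f g : PMap A X) : Prop :=
  f.toMap.HomotopicRel g.toMap {A.pt}

/-- Pointed homotopy is an equivalence relation. -/
instance setoid (A : PSpace.{u}) (X : PSpace.{v}) : Setoid (PMap A X) where
  r := Homotopic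
  iseqv := ⟨fun _ => ContinuousMap.HomotopicRel.refl _, fun h => h.symm, fun h k => h.trans k⟩

theorem Homotopic.postcomp {A : PSpace.{u}} {B : PSpace.{v}} {X : PSpace.{w}} {f g : PMap A B}
    (h : f.Homotopic g) (k : PMap B X) : (k.comp f).Homotopic (k.comp g) :=
  ContinuousMap.HomotopicRel.comp_continuousMap h k.toMap

theorem Homotopic.precomp {A : PSpace.{u}} {B : PSpace.{v}} {X : PSpace.{w}} {f g : PMap B X}
    (h : f.Homotopic g) (k : PMap A B) : (f.comp k).Homotopic (g.comp k) := by
  obtain ⟨H⟩ := h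
  refine ⟨⟨⟨⟨fun p => H (p.1, k.toMap p.2), by fun_prop⟩, ?_, ?_⟩, ?_⟩⟩
  · intro x; simp [comp]
  · intro x; simp [comp]
  · rintro t x rfl
    have := H.eq_fst t (x := B.pt) rfl
    simpa [comp, k.map_pt] using this

end PMap

/-- A pointed homotopy equivalence. -/
def IsHEquiv {A : PSpace.{u}} {B : PSpace.{v}} (f : PMap A B) : Prop :=
  ∃ g : PMap B A, (g.comp f).Homotopic (PMap.id A) ∧ (f.comp g).Homotopic (PMap.id B)

/-- The set `[A, X]` of pointed homotopy classes of pointed maps. -/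
def HClass (A : PSpace.{u}) (X : PSpace.{v}) : Type (max u v) := Quotient (PMap.setoid A X)

/-- The function `f^* : [B, X] → [A, X]` induced by a pointed map `f : A → B`. -/
def HClass.pull {A : PSpace.{u}} {B : PSpace.{v}} {X : PSpace.{w}} (f : PMap A B) :
    HClass B X → HClass A X :=
  Quotient.map (fun g => g.comp f) fun _ _ h => PMap.Homotopic.precomp h f

/-! Collapsing a subspace to a point -/

/-- The quotient space `A / S` in which the subset `S` (containing the base point in every use
below) is collapsed to one point, the base point. -/
def collapse (A : PSpace.{u}) (S : Set A) : PSpace.{u} where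
  carrier := Quot fun x y : A => x ∈ S ∧ y ∈ S
  top := inferInstance
  pt := Quot.mk _ A.pt

/-- The projection `A → A / S`. -/
def collapse.mk (A : PSpace.{u}) (S : Set A) : PMap A (collapse A S) :=
  ⟨⟨Quot.mk _, continuous_quot_mk⟩, rfl⟩

/-- The pointed map `A / S → X` induced by a pointed map `A → X` that is trivial on `S`. -/
def collapse.lift {A : PSpace.{u}} {S : Set A} {X : PSpace.{v}} (f : PMap A X)
    (hf : ∀ x ∈ S, f.toMap x = X.pt) : PMap (collapse A S) X :=
  ⟨⟨Quot.lift f.toMap fun x y h => (hf x h.1).trans (hf y h.2).symm,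
    continuous_quot_lift _ f.toMap.continuous⟩, f.map_pt⟩

theorem collapse.lift_homotopic {A : PSpace.{u}} {S : Set A} {X : PSpace.{v}} {f g : PMap A X}
    (hf : ∀ x ∈ S, f.toMap x = X.pt) (hg : ∀ x ∈ S, g.toMap x = X.pt)
    (H : f.toMap.HomotopyRel g.toMap (insert A.pt S)) :
    (collapse.lift f hf).Homotopic (collapse.lift g hg) := by
  have hH : ∀ t, ∀ x ∈ S, H (t, x) = X.pt := fun t x hx =>
    (H.eq_fst t (Set.mem_insert_of_mem _ hx)).trans (hf x hx)
  let K : I × collapse A S → X := fun p =>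
    Quot.lift (fun x => H (p.1, x)) (fun x y h => (hH _ x h.1).trans (hH _ y h.2).symm) p.2
  have hq : IsQuotientMap (collapse.mk A S).toMap := isQuotientMap_quot_mk
  have hK : Continuous K := by
    refine hq.continuous_lift_prod_right ?_
    exact H.continuous
  refine ⟨⟨⟨⟨K, hK⟩, ?_, ?_⟩, ?_⟩⟩
  · rintro ⟨x⟩; exact H.apply_zero x
  · rintro ⟨x⟩; exact H.apply_one x
  · rintro t x rfl
    exact H.eq_fst t (Set.mem_insert _ _)

/-! Wedges -/

/-- The disjoint union, with the base point of the first summand. -/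
def psum (A B : PSpace.{u}) : PSpace.{u} where
  carrier := A.carrier ⊕ B.carrier
  top := inferInstance
  pt := Sum.inl A.pt

/-- The wedge `A ∨ B`. -/
def wedge (A B : PSpace.{u}) : PSpace.{u} :=
  collapse (psum A B) {x | x = Sum.inl A.pt ∨ x = Sum.inr B.pt}

namespace wedge

/-- The inclusion `A → A ∨ B`. -/
def inl (A B : PSpace.{u}) : PMap A (wedge A B) :=
  ⟨(collapse.mk (psum A B) _).toMap.comp ⟨(Sum.inl : A.carrier → A.carrier ⊕ B.carrier),
    continuous_inl⟩, rfl⟩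

/-- The inclusion `B → A ∨ B`. -/
def inr (A B : PSpace.{u}) : PMap B (wedge A B) :=
  ⟨(collapse.mk (psum A B) _).toMap.comp ⟨(Sum.inr : B.carrier → A.carrier ⊕ B.carrier),
    continuous_inr⟩, Quot.sound ⟨Or.inr rfl, Or.inl rfl⟩⟩

/-- The map of the disjoint union given by `f` and `g`. -/
def sumElim {A B : PSpace.{u}} {X : PSpace.{v}} (f : PMap A X) (g : PMap B X) :
    PMap (psum A B) X :=
  ⟨⟨(Sum.elim f.toMap g.toMap : A.carrier ⊕ B.carrier → X),
    f.toMap.continuous.sumElim g.toMap.continuous⟩, f.map_pt⟩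

theorem sumElim_pt {A B : PSpace.{u}} {X : PSpace.{v}} (f : PMap A X) (g : PMap B X) :
    ∀ x ∈ {x : psum A B | x = Sum.inl A.pt ∨ x = Sum.inr B.pt},
      (sumElim f g).toMap x = X.pt := by
  rintro x (rfl | rfl)
  · exact f.map_pt
  · exact g.map_pt

/-- The map `A ∨ B → X` which is `f` on `A` and `g` on `B`. -/
def desc {A B : PSpace.{u}} {X : PSpace.{v}} (f : PMap A X) (g : PMap B X) :
    PMap (wedge A B) X :=
  collapse.lift (sumElim f g) (sumElim_pt f g)

theorem desc_homotopic {A B : PSpace.{u}} {X : PSpace.{v}} {f f' : PMap A X} {g g' : PMap B X}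
    (hf : f.Homotopic f') (hg : g.Homotopic g') : (desc f g).Homotopic (desc f' g') := by
  obtain ⟨F⟩ := hf
  obtain ⟨G⟩ := hg
  let H : I × (A.carrier ⊕ B.carrier) → X :=
    fun p => Sum.elim (fun a => F (p.1, a)) (fun b => G (p.1, b)) p.2
  have hH : Continuous H := by
    have h : Continuous (H ∘ (Homeomorph.prodSumDistrib (X := I) (Y := A) (Z := B)).symm) := by
      rw [continuous_sum_dom]
      exact ⟨F.continuous, G.continuous⟩
    simpa [Function.comp_assoc] using h.comp (Homeomorph.prodSumDistrib (X := I)).continuous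
  refine collapse.lift_homotopic _ _ ⟨⟨⟨H, hH⟩, ?_, ?_⟩, ?_⟩
  · rintro (a | b)
    · exact F.apply_zero a
    · exact G.apply_zero b
  · rintro (a | b)
    · exact F.apply_one a
    · exact G.apply_one b
  · rintro t x (rfl | rfl | rfl)
    · exact F.eq_fst t rfl
    · exact F.eq_fst t rfl
    · exact G.eq_fst t rfl

/-- The interchange map `T : A ∨ A → A ∨ A`. -/
def swap (A : PSpace.{u}) : PMap (wedge A A) (wedge A A) := desc (inr A A) (inl A A)

end wedge

/-! Reduced suspensions -/

/-- The cylinder `A × [0,1]`. -/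
def cyl (A : PSpace.{u}) : PSpace.{u} where
  carrier := A.carrier × I
  top := inferInstance
  pt := (A.pt, 0)

/-- The part of the cylinder that is collapsed in the reduced suspension. -/
def suspEnds (A : PSpace.{u}) : Set (cyl A) :=
  {p : A.carrier × I | p.1 = A.pt ∨ p.2 = 0 ∨ p.2 = 1}

/-- The reduced suspension `ΣA`. -/
def Susp (A : PSpace.{u}) : PSpace.{u} := collapse (cyl A) (suspEnds A)

namespace Susp

/-- The point `[a, t]` of `ΣA`. -/
def mk {A : PSpace.{u}} (a : A) (t : I) : Susp A := (collapse.mk (cyl A) (suspEnds A)).toMap (a, t)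

theorem continuous_mk (A : PSpace.{u}) : Continuous fun p : A × I => mk p.1 p.2 :=
  (collapse.mk (cyl A) (suspEnds A)).toMap.continuous

theorem mk_eq_pt {A : PSpace.{u}} {a : A} {t : I} (h : a = A.pt ∨ t = 0 ∨ t = 1) :
    mk a t = (Susp A).pt :=
  Quot.sound ⟨h, Or.inl rfl⟩

/-- `Σf`, given by `[a, t] ↦ [f a, t]`. -/
def map {A B : PSpace.{u}} (f : PMap A B) : PMap (Susp A) (Susp B) :=
  collapse.lift (A := cyl A) (S := suspEnds A) (X := Susp B)
    ⟨⟨fun p : A × I => mk (f.toMap p.1) p.2, (continuous_mk B).comp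
      ((f.toMap.continuous.comp continuous_fst).prodMk continuous_snd)⟩,
      mk_eq_pt (Or.inl f.map_pt)⟩ (by
    rintro ⟨a, t⟩ (h | h)
    · exact mk_eq_pt (Or.inl (by rw [show a = A.pt from h]; exact f.map_pt))
    · exact mk_eq_pt (Or.inr h))

/-- The inversion `[a, t] ↦ [a, 1 - t]` of `ΣA`. -/
def rev (A : PSpace.{u}) : PMap (Susp A) (Susp A) :=
  collapse.lift (A := cyl A) (S := suspEnds A) (X := Susp A)
    ⟨⟨fun p : A × I => mk p.1 (σ p.2), (continuous_mk A).comp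
      (continuous_fst.prodMk (unitInterval.continuous_symm.comp continuous_snd))⟩,
      mk_eq_pt (Or.inl rfl)⟩ (by
    rintro ⟨a, t⟩ (h | h | h)
    · exact mk_eq_pt (Or.inl h)
    · exact mk_eq_pt (Or.inr (Or.inr (by rw [show t = 0 from h]; exact unitInterval.symm_zero)))
    · exact mk_eq_pt (Or.inr (Or.inl (by rw [show t = 1 from h]; exact unitInterval.symm_one))))

/-- The comultiplication on the cylinder: `(a, t)` goes to `[a, 2t]` in the first copy of `ΣA`
if `t ≤ 1/2`, and to `[a, 2t - 1]` in the second copy otherwise. -/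
def comultFun (A : PSpace.{u}) (p : A × I) : wedge (Susp A) (Susp A) :=
  if (p.2 : ℝ) ≤ 1 / 2 then
    (wedge.inl (Susp A) (Susp A)).toMap (mk p.1 (Set.projIcc 0 1 zero_le_one (2 * (p.2 : ℝ))))
  else
    (wedge.inr (Susp A) (Susp A)).toMap (mk p.1 (Set.projIcc 0 1 zero_le_one (2 * (p.2 : ℝ) - 1)))

theorem continuous_comultFun (A : PSpace.{u}) : Continuous (comultFun A) := by
  unfold comultFun
  refine Continuous.if_le ?_ ?_ (by fun_prop) continuous_const ?_
  · have h : Continuous fun p : A × I =>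
        (p.1, Set.projIcc (0 : ℝ) 1 zero_le_one (2 * (p.2 : ℝ))) := by fun_prop
    exact (wedge.inl (Susp A) (Susp A)).toMap.continuous.comp ((continuous_mk A).comp h)
  · have h : Continuous fun p : A × I =>
        (p.1, Set.projIcc (0 : ℝ) 1 zero_le_one (2 * (p.2 : ℝ) - 1)) := by fun_prop
    exact (wedge.inr (Susp A) (Susp A)).toMap.continuous.comp ((continuous_mk A).comp h)
  · rintro ⟨a, t⟩ h
    have h' : (t : ℝ) = 1 / 2 := h
    rw [mk_eq_pt (Or.inr (Or.inr ?_)), mk_eq_pt (Or.inr (Or.inl ?_)), PMap.map_pt, PMap.map_pt]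
    · exact Set.projIcc_of_le_left _ (by simp [h'])
    · exact Set.projIcc_of_right_le _ (by simp [h'])

theorem comultFun_pt {A : PSpace.{u}} (p : A × I) (h : p ∈ suspEnds A) :
    comultFun A p = (wedge (Susp A) (Susp A)).pt := by
  obtain ⟨a, t⟩ := p
  unfold comultFun
  split_ifs with ht
  · rw [mk_eq_pt, PMap.map_pt]
    rcases h with h | h | h
    · exact Or.inl h
    · refine Or.inr (Or.inl (Set.projIcc_of_le_left _ ?_))
      simp [show t = 0 from h]
    · norm_num [show t = 1 from h] at ht
  · rw [mk_eq_pt, PMap.map_pt]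
    rcases h with h | h | h
    · exact Or.inl h
    · norm_num [show t = 0 from h] at ht
    · refine Or.inr (Or.inr (Set.projIcc_of_right_le _ ?_))
      norm_num [show t = 1 from h]

/-- The suspension comultiplication `ν : ΣA → ΣA ∨ ΣA`. -/
def comult (A : PSpace.{u}) : PMap (Susp A) (wedge (Susp A) (Susp A)) :=
  collapse.lift (A := cyl A) (S := suspEnds A)
    ⟨⟨comultFun A, continuous_comultFun A⟩, comultFun_pt (A.pt, 0) (Or.inl rfl)⟩ comultFun_pt

/-- `ΣA` is homotopy co-commutative: `T ∘ ν` and `ν` are homotopic. -/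
def CoCommutative (A : PSpace.{u}) : Prop :=
  ((wedge.swap (Susp A)).comp (comult A)).Homotopic (comult A)

end Susp

/-! The group operations on `[ΣA, X]`, written multiplicatively -/

section Group

variable {A : PSpace.{u}} {X : PSpace.{v}}

/-- The product of the classes of `f` and `g` is the class of `(f, g) ∘ ν`. -/
instance : Mul (HClass (Susp A) X) :=
  ⟨Quotient.map₂ (fun f g => (wedge.desc f g).comp (Susp.comult A)) fun _ _ hf _ _ hg =>
    (wedge.desc_homotopic hf hg).precomp _⟩

/-- The inverse of a class is its composite with the inversion of `ΣA`. -/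
instance : Inv (HClass (Susp A) X) := ⟨HClass.pull (Susp.rev A)⟩

/-- The neutral element is the class of the constant map. -/
instance : One (HClass (Susp A) X) := ⟨Quotient.mk _ (PMap.const _ _)⟩

/-- The commutator `(x, y) = x y x⁻¹ y⁻¹`. -/
def comm (x y : HClass (Susp A) X) : HClass (Susp A) X := x * y * x⁻¹ * y⁻¹

/-- The conjugate `x^y = y x y⁻¹`. -/
def conj (x y : HClass (Susp A) X) : HClass (Susp A) X := y * x * y⁻¹

end Group

/-! Products and smash products, in the sense of compactly generated spaces -/

/-- The product `A × B` with the compactly generated topology. -/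
def kprod (A B : PSpace.{u}) : PSpace.{u} where
  carrier := A.carrier × B.carrier
  top := TopologicalSpace.compactlyGenerated.{u} (A.carrier × B.carrier)
  pt := (A.pt, B.pt)

namespace kprod

/-- The identity function from the product with its compactly generated topology to the product
with its product topology. -/
def toProd (A B : PSpace.{u}) : kprod A B → A.carrier × B.carrier := fun p => p

/-- The inverse of `toProd`. -/
def ofProd (A B : PSpace.{u}) : A.carrier × B.carrier → kprod A B := fun p => p

theorem continuous_toProd (A B : PSpace.{u}) : Continuous (toProd A B) :=
  continuous_from_compactlyGenerated (X := A.carrier × B.carrier) (toProd A B)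
    fun _ g => g.continuous

theorem continuous_ofProd_comp {A B : PSpace.{u}} (S : CompHaus.{u})
    (g : C(S, A.carrier × B.carrier)) : Continuous (ofProd A B ∘ g) := by
  refine continuous_def.2 fun s hs => ?_
  have h := isOpen_sigma_iff.1 (isOpen_coinduced.1 hs)
  exact h ⟨S, g⟩

/-- The projection `A × B → A`. -/
def fst (A B : PSpace.{u}) : PMap (kprod A B) A :=
  ⟨⟨fun p => (toProd A B p).1, continuous_fst.comp (continuous_toProd A B)⟩, rfl⟩

/-- The projection `A × B → B`. -/
def snd (A B : PSpace.{u}) : PMap (kprod A B) B :=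
  ⟨⟨fun p => (toProd A B p).2, continuous_snd.comp (continuous_toProd A B)⟩, rfl⟩

/-- The map `(f, g)` from a product `D × E` to a product `A × B`. -/
def pair {D E A B : PSpace.{u}} (f : PMap (kprod D E) A) (g : PMap (kprod D E) B) :
    PMap (kprod D E) (kprod A B) :=
  ⟨⟨fun p => ofProd A B (f.toMap p, g.toMap p), by
    refine continuous_from_compactlyGenerated (X := D.carrier × E.carrier) _ fun S k => ?_
    have hk := continuous_ofProd_comp (A := D) (B := E) S k
    exact continuous_ofProd_comp S
      ⟨fun s => (f.toMap (ofProd D E (k s)), g.toMap (ofProd D E (k s))),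
        (f.toMap.continuous.comp hk).prodMk (g.toMap.continuous.comp hk)⟩⟩,
    Prod.ext f.map_pt g.map_pt⟩

end kprod

/-- The smash product `A ∧ B = (A × B) / (A ∨ B)`. -/
def smash (A B : PSpace.{u}) : PSpace.{u} :=
  collapse (kprod A B) {p : A.carrier × B.carrier | p.1 = A.pt ∨ p.2 = B.pt}

/-- The projection `A × B → A ∧ B`. -/
def smash.proj (A B : PSpace.{u}) : PMap (kprod A B) (smash A B) := collapse.mk _ _

/-- The product `A × B × C`. -/
abbrev kprod3 (A B C : PSpace.{u}) : PSpace.{u} := kprod (kprod A B) C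

namespace kprod3

variable (A B C : PSpace.{u})

/-- The projection to the first factor. -/
def p1 : PMap (kprod3 A B C) A := (kprod.fst A B).comp (kprod.fst (kprod A B) C)

/-- The projection to the second factor. -/
def p2 : PMap (kprod3 A B C) B := (kprod.snd A B).comp (kprod.fst (kprod A B) C)

/-- The projection to the third factor. -/
def p3 : PMap (kprod3 A B C) C := kprod.snd (kprod A B) C

/-- The map to a triple product with given components. -/
def triple {A B C D E F : PSpace.{u}} (f : PMap (kprod3 A B C) D) (g : PMap (kprod3 A B C) E)
    (h : PMap (kprod3 A B C) F) : PMap (kprod3 A B C) (kprod3 D E F) :=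
  kprod.pair (kprod.pair f g) h

/-- The twisting function `(a, b, c) ↦ (b, a, c)`. -/
def t213 : PMap (kprod3 A B C) (kprod3 B A C) := triple (p2 A B C) (p1 A B C) (p3 A B C)

/-- The twisting function `(a, b, c) ↦ (c, b, a)`. -/
def t321 : PMap (kprod3 A B C) (kprod3 C B A) := triple (p3 A B C) (p2 A B C) (p1 A B C)

/-- The twisting function `(a, b, c) ↦ (a, c, b)`. -/
def t132 : PMap (kprod3 A B C) (kprod3 A C B) := triple (p1 A B C) (p3 A B C) (p2 A B C)

/-- The twisting function `(a, b, c) ↦ (c, a, b)`. -/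
def t312 : PMap (kprod3 A B C) (kprod3 C A B) := triple (p3 A B C) (p1 A B C) (p2 A B C)

/-- The twisting function `(a, b, c) ↦ (b, c, a)`. -/
def t231 : PMap (kprod3 A B C) (kprod3 B C A) := triple (p2 A B C) (p3 A B C) (p1 A B C)

end kprod3

/-- The points of `A × B × C` that have a coordinate at the base point. -/
def fatWedge (A B C : PSpace.{u}) : Set (kprod3 A B C) :=
  {p : (A.carrier × B.carrier) × C.carrier | p.1.1 = A.pt ∨ p.1.2 = B.pt ∨ p.2 = C.pt}

/-- The smash product `A ∧ B ∧ C`, the quotient of `A × B × C` by the fat wedge. -/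
def smash3 (A B C : PSpace.{u}) : PSpace.{u} := collapse (kprod3 A B C) (fatWedge A B C)

namespace smash3

variable (A B C : PSpace.{u})

/-- The projection `A × B × C → A ∧ B ∧ C`. -/
def proj : PMap (kprod3 A B C) (smash3 A B C) := collapse.mk _ _

variable {A B C} in
/-- A map of triple products that preserves the fat wedges induces a map of smash products. -/
def map {D E F : PSpace.{u}} (t : PMap (kprod3 A B C) (kprod3 D E F))
    (ht : ∀ x ∈ fatWedge A B C, t.toMap x ∈ fatWedge D E F) :
    PMap (smash3 A B C) (smash3 D E F) :=
  collapse.lift ((proj D E F).comp t) fun x hx =>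
    Quot.sound ⟨ht x hx, Or.inl rfl⟩

/-- The twisting function `t₂₁₃ : A ∧ B ∧ C → B ∧ A ∧ C`. -/
def t213 : PMap (smash3 A B C) (smash3 B A C) :=
  map (kprod3.t213 A B C) (by
    rintro x (h | h | h)
    · exact Or.inr (Or.inl h)
    · exact Or.inl h
    · exact Or.inr (Or.inr h))

/-- The twisting function `t₃₂₁ : A ∧ B ∧ C → C ∧ B ∧ A`. -/
def t321 : PMap (smash3 A B C) (smash3 C B A) :=
  map (kprod3.t321 A B C) (by
    rintro x (h | h | h)
    · exact Or.inr (Or.inr h)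
    · exact Or.inr (Or.inl h)
    · exact Or.inl h)

/-- The twisting function `t₁₃₂ : A ∧ B ∧ C → A ∧ C ∧ B`. -/
def t132 : PMap (smash3 A B C) (smash3 A C B) :=
  map (kprod3.t132 A B C) (by
    rintro x (h | h | h)
    · exact Or.inl h
    · exact Or.inr (Or.inr h)
    · exact Or.inr (Or.inl h))

/-- The twisting function `t₃₁₂ : A ∧ B ∧ C → C ∧ A ∧ B`. -/
def t312 : PMap (smash3 A B C) (smash3 C A B) :=
  map (kprod3.t312 A B C) (by
    rintro x (h | h | h)
    · exact Or.inr (Or.inl h)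
    · exact Or.inr (Or.inr h)
    · exact Or.inl h)

/-- The twisting function `t₂₃₁ : A ∧ B ∧ C → B ∧ C ∧ A`. -/
def t231 : PMap (smash3 A B C) (smash3 B C A) :=
  map (kprod3.t231 A B C) (by
    rintro x (h | h | h)
    · exact Or.inr (Or.inr h)
    · exact Or.inl h
    · exact Or.inr (Or.inl h))

/-- The natural map `A ∧ B ∧ C → (A ∧ B) ∧ C`. -/
def toSmash : PMap (smash3 A B C) (smash (smash A B) C) :=
  collapse.lift
    ((smash.proj (smash A B) C).comp
      (kprod.pair ((smash.proj A B).comp (kprod.fst (kprod A B) C)) (kprod.snd (kprod A B) C)))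
    (by
      have key : ∀ x : kprod3 A B C, (Prod.fst (Prod.fst x) = A.pt ∨ Prod.snd (Prod.fst x) = B.pt) →
          (smash.proj A B).toMap (Prod.fst x) = (smash A B).pt := fun x h =>
        Quot.sound ⟨h, Or.inl rfl⟩
      rintro x (h | h | h)
      · exact Quot.sound ⟨Or.inl (key x (Or.inl h)), Or.inl rfl⟩
      · exact Quot.sound ⟨Or.inl (key x (Or.inr h)), Or.inl rfl⟩
      · exact Quot.sound ⟨Or.inr h, Or.inl rfl⟩)

end smash3

/-! Fox groups -/

/-- `W ⊔ *`, the space `W` with a disjoint base point. -/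
def addPt (W : PSpace.{u}) : PSpace.{u} where
  carrier := W.carrier ⊕ PUnit.{u + 1}
  top := inferInstance
  pt := Sum.inr PUnit.unit

/-- The pointed map `W ⊔ * → V` that is `f` on `W`; `f` need not preserve base points. -/
def addPt.desc {W V : PSpace.{u}} (f : C(W, V)) : PMap (addPt W) V :=
  ⟨⟨(Sum.elim f fun _ => V.pt : W.carrier ⊕ PUnit.{u + 1} → V),
    f.continuous.sumElim continuous_const⟩, rfl⟩

/-- The map `f ⊔ * : W ⊔ * → V ⊔ *`. -/
def addPt.map {W V : PSpace.{u}} (f : C(W, V)) : PMap (addPt W) (addPt V) :=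
  addPt.desc (V := addPt V)
    ⟨(fun w => Sum.inl (f w) : W → V.carrier ⊕ PUnit.{u + 1}), continuous_inl.comp f.continuous⟩

/-- The Fox group `τ_W(X) = [Σ(W ⊔ *), X]`. -/
abbrev Fox (W : PSpace.{u}) (X : PSpace.{v}) : Type (max u v) := HClass (Susp (addPt W)) X

/-- The function `[ΣV, X] → τ_W(X)` induced by `W ⊔ * → V`, for a map `f : W → V`. -/
def Fox.image {W V : PSpace.{u}} {X : PSpace.{v}} (f : C(W, V)) (ξ : HClass (Susp V) X) :
    Fox W X :=
  HClass.pull (Susp.map (addPt.desc f)) ξ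

/-- The function `τ_V(X) → τ_W(X)` induced by a map `f : W → V`. -/
def Fox.pull {W V : PSpace.{u}} {X : PSpace.{v}} (f : C(W, V)) (ξ : Fox V X) : Fox W X :=
  HClass.pull (Susp.map (addPt.map f)) ξ

/-! Generalized Whitehead products -/

/-- `κ ∈ [Σ(A ∧ B), X]` is a generalized Whitehead product of `ξ` and `η`: a representative of `κ`,
composed with `Σ(A × B) → Σ(A ∧ B)`, is homotopic to `f' · g' · f'⁻¹ · g'⁻¹`, where `f` and `g`
represent `ξ` and `η`, `f' = f ∘ Σp_A` and `g' = g ∘ Σp_B`. -/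
def IsGWP {A B : PSpace.{u}} {X : PSpace.{v}} (ξ : HClass (Susp A) X) (η : HClass (Susp B) X)
    (κ : HClass (Susp (smash A B)) X) : Prop :=
  κ.pull (Susp.map (smash.proj A B)) =
    comm (ξ.pull (Susp.map (kprod.fst A B))) (η.pull (Susp.map (kprod.snd A B)))

/-- The generalized Whitehead product `[ξ, η] ∈ [Σ(A ∧ B), X]`. -/
def gwp {A B : PSpace.{u}} {X : PSpace.{v}} (ξ : HClass (Susp A) X) (η : HClass (Susp B) X) :
    HClass (Susp (smash A B)) X :=
  @Classical.epsilon _ ⟨1⟩ (IsGWP ξ η)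

/-- The iterated product `[[ξ, η], ζ]`, as an element of `[Σ(A ∧ B ∧ C), X]`. -/
def gwp3 {A B C : PSpace.{u}} {X : PSpace.{v}} (ξ : HClass (Susp A) X) (η : HClass (Susp B) X)
    (ζ : HClass (Susp C) X) : HClass (Susp (smash3 A B C)) X :=
  (gwp (gwp ξ η) ζ).pull (Susp.map (smash3.toSmash A B C))

/-! The sphere `S⁰`, and the action of the fundamental group -/

/-- The sphere `S⁰`: two points, discrete, with base point `false`. -/
def S0 : PSpace.{u} where
  carrier := ULift.{u} Bool
  top := ⊥
  pt := ⟨false⟩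

/-- The image in `τ_W(X)` of an element of `π₁(X) = [S¹, X] = [ΣS⁰, X]`, by way of the map
`W ⊔ * → S⁰` that takes `W` to the point other than the base point. -/
def piOneImage (W : PSpace.{u}) {X : PSpace.{v}} (ω : HClass (Susp S0.{u}) X) : Fox W X :=
  Fox.image (ContinuousMap.const W (ULift.up true : S0.{u})) ω

/-- `θ` is the result of the classical action of `ω ∈ π₁(X)` on `η ∈ [ΣW, X]`, which is the action
in the decomposition of `τ_W(X)` as the semidirect product of `[ΣW, X]` and `π₁(X)`. -/
def IsAction {W : PSpace.{u}} {X : PSpace.{v}} (ω : HClass (Susp S0.{u}) X)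
    (η θ : HClass (Susp W) X) : Prop :=
  Fox.image (ContinuousMap.id W) θ = conj (Fox.image (ContinuousMap.id W) η) (piOneImage W ω)

/-- The classical action `η^ω` of `ω ∈ π₁(X)` on `η ∈ [ΣW, X]`. -/
def action {W : PSpace.{u}} {X : PSpace.{v}} (ω : HClass (Susp S0.{u}) X)
    (η : HClass (Susp W) X) : HClass (Susp W) X :=
  @Classical.epsilon _ ⟨1⟩ (IsAction ω η)

open Classical in
/-- `ξ · η` for `ξ ∈ [ΣA, X]`: this is `η^ξ` if `A` is `S⁰` (up to pointed homotopy equivalence),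
so that `ξ` is an element of `π₁(X)`, and `η` otherwise. -/
def dot {A W : PSpace.{u}} {X : PSpace.{v}} (ξ : HClass (Susp A) X) (η : HClass (Susp W) X) :
    HClass (Susp W) X :=
  if h : ∃ s : PMap S0.{u} A, IsHEquiv s then action (ξ.pull (Susp.map h.choose)) η else η

/-! The spaces considered -/

/-- `A` is well-pointed: its base point is an NDR (for Hausdorff spaces: the inclusion of the
base point is a closed cofibration). -/
def WellPointed (A : PSpace.{u}) : Prop :=
  ∃ (r : C(A, I)) (h : C(A × I, A)),
    (∀ a, r a = 0 ↔ a = A.pt) ∧ (∀ a, h (a, 0) = a) ∧ (∀ t, h (A.pt, t) = A.pt) ∧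
      ∀ a, r a < 1 → h (a, 1) = A.pt

/-- `A` has the pointed homotopy type of a well-pointed compactly generated Hausdorff space. -/
def HasCGHType (A : PSpace.{u}) : Prop :=
  ∃ A' : PSpace.{u}, T2Space A' ∧ CompactlyGeneratedSpace A' ∧ WellPointed A' ∧
    ∃ f : PMap A A', IsHEquiv f

end Jacobi

end

/-!
By the adjunction between suspension and loops, a class in `[ΣV, X]` gives a free homotopy class of
maps from `V` to `ΩX`, and free homotopy classes form a group that is functorial in arbitrary maps
of the source. If `V` is well-pointed, pointed classes embed in free ones, because a free homotopy
`f ≃ g` can be corrected by the loop that it traces at the base point. The same argument, repeated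
along the three faces of the fat wedge, embeds `[Σ(A ∧ B ∧ C), X]` in the free classes on
`A × B × C`, where it is the common kernel of the restrictions to the faces. There the iterated
generalized Whitehead products are iterated commutators, and (1) is the identity of Hall and Witt.

If `ΣA` is homotopy co-commutative, so that `[ΣA, Z]` is commutative for every `Z`, the exponential
law with `Z = C(B × C, X)` shows that the kernel of the restriction to `* × B × C` is commutative.
The class `α` lies in this kernel, hence commutes with every commutator that involves it, and the
conjugations and inverses in the identity of Hall and Witt disappear. If `A = S⁰`, then
`A × B × C` is the disjoint union of two copies of `B × C`. On the one over the base point all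
classes in question are trivial, and on the other one `α` is constant, so conjugation by `α` is the
action of `π₁(X)`.
-/

noncomputable section

namespace Jacobi

open Topology unitInterval
open scoped commutatorElement

/-! ### Free homotopy classes of maps to a loop space -/

/-- The set of loops of a pointed space, with the compact-open topology. -/
abbrev Loops (X : PSpace.{v}) : Type v := Path X.pt X.pt

/-- The loop space `ΩX`, pointed by the constant loop. -/
abbrev loopSpace (X : PSpace.{v}) : PSpace.{v} := ⟨Loops X, inferInstance, Path.refl X.pt⟩

namespace Loops

variable {X : PSpace.{v}}

/-- Concatenation of loops, the multiplication of the H-space `ΩX`. -/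
def mul : C(Loops X × Loops X, Loops X) := ⟨fun p => p.1.trans p.2, Path.continuous_trans⟩

/-- Reversal of loops, the homotopy inversion of the H-space `ΩX`. -/
def inv : C(Loops X, Loops X) := ⟨Path.symm, Path.continuous_symm⟩

/-- The contraction of `p · p⁻¹`, jointly continuous in the loop and the time of the homotopy. It
starts at the constant loop. -/
def cancel : C(I × Loops X, Loops X) where
  toFun z := (Path.Homotopy.reflTransSymm z.2).eval z.1
  continuous_toFun := by
    refine Path.continuous_uncurry_iff.1 ?_
    have h : Continuous fun z : (I × Loops X) × I =>
        z.1.2 ⟨Path.Homotopy.reflTransSymmAux (z.1.1, z.2),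
          Path.Homotopy.reflTransSymmAux_mem_I _⟩ := by fun_prop
    exact h

theorem cancel_zero (p : Loops X) : cancel (0, p) = Path.refl _ :=
  (Path.Homotopy.reflTransSymm p).eval_zero

theorem cancel_one (p : Loops X) : cancel (1, p) = p.trans p.symm :=
  (Path.Homotopy.reflTransSymm p).eval_one

theorem cancel_refl (t : I) : cancel (t, Path.refl X.pt) = Path.refl _ := rfl

/-- The associativity homotopy of `ΩX`, jointly continuous in the loops and the time. -/
def assoc : C(I × (Loops X × Loops X × Loops X), Loops X) where
  toFun z := (Path.Homotopy.transAssoc z.2.1 z.2.2.1 z.2.2.2).eval z.1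
  continuous_toFun := by
    refine Path.continuous_uncurry_iff.1 ?_
    have hc : Continuous fun z : (I × (Loops X × Loops X × Loops X)) × I =>
        z.1.2.1.trans (z.1.2.2.1.trans z.1.2.2.2) :=
      Continuous.path_trans (by fun_prop) (Continuous.path_trans (by fun_prop) (by fun_prop))
    let r (t : I) : I := ⟨_, Path.Homotopy.transAssocReparamAux_mem_I t⟩
    have hr (s t : I) : (σ (σ s) * t + σ s * r t : ℝ) ∈ I :=
      convex_Icc _ _ t.2 (r t).2 (σ (σ s)).2.1 (σ s).2.1 (by simp)
    have h : Continuous fun z : (I × (Loops X × Loops X × Loops X)) × I =>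
        (z.1.2.1.trans (z.1.2.2.1.trans z.1.2.2.2)) ⟨_, hr z.1.1 z.2⟩ := by
      refine hc.eval ?_
      fun_prop
    exact h

theorem assoc_zero (p : Loops X × Loops X × Loops X) :
    assoc (0, p) = (p.1.trans p.2.1).trans p.2.2 :=
  (Path.Homotopy.transAssoc p.1 p.2.1 p.2.2).eval_zero

theorem assoc_one (p : Loops X × Loops X × Loops X) :
    assoc (1, p) = p.1.trans (p.2.1.trans p.2.2) :=
  (Path.Homotopy.transAssoc p.1 p.2.1 p.2.2).eval_one

end Loops

/-- The set of free homotopy classes of maps from `W` to the loop space of `X`; a group under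
concatenation of loops. -/
def LoopClass (W : Type u) [TopologicalSpace W] (X : PSpace.{v}) : Type (max u v) :=
  Quotient (⟨ContinuousMap.Homotopic, ContinuousMap.Homotopic.equivalence⟩ : Setoid C(W, Loops X))

namespace LoopClass

variable {U V W : Type*} [TopologicalSpace U] [TopologicalSpace V] [TopologicalSpace W]
  {X : PSpace.{v}}

/-- The class of a map. -/
def mk (f : C(W, Loops X)) : LoopClass W X := Quotient.mk _ f

theorem mk_eq_iff {f g : C(W, Loops X)} : mk f = mk g ↔ f.Homotopic g := Quotient.eq

theorem ind {p : LoopClass W X → Prop} (h : ∀ f, p (mk f)) (x : LoopClass W X) : p x :=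
  Quotient.ind h x

/-- The constant map at the constant loop, which represents the unit. -/
def cst (W : Type u) [TopologicalSpace W] (X : PSpace.{v}) : C(W, Loops X) :=
  ContinuousMap.const W (Path.refl X.pt)

/-- The pointwise concatenation of maps to the loop space. -/
def mulMap (f g : C(W, Loops X)) : C(W, Loops X) := Loops.mul.comp (f.prodMk g)

/-- The pointwise reversal of a map to the loop space. -/
def invMap (f : C(W, Loops X)) : C(W, Loops X) := Loops.inv.comp f

theorem mulMap_homotopic {f f' g g' : C(W, Loops X)} (hf : f.Homotopic f') (hg : g.Homotopic g') :
    (mulMap f g).Homotopic (mulMap f' g') :=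
  (ContinuousMap.Homotopic.refl Loops.mul).comp (hf.prodMk hg)

theorem mulMap_assoc (f g h : C(W, Loops X)) :
    (mulMap (mulMap f g) h).Homotopic (mulMap f (mulMap g h)) :=
  ⟨⟨Loops.assoc.comp ((ContinuousMap.id I).prodMap (f.prodMk (g.prodMk h))),
    fun x => Loops.assoc_zero (f x, g x, h x), fun x => Loops.assoc_one (f x, g x, h x)⟩⟩

theorem mulMap_cst (f : C(W, Loops X)) :
    (mulMap f (cst W X)).HomotopicRel f {w | f w = Path.refl _} :=
  let H := HSpace.hmulE (X := Loops X)
  ⟨⟨⟨H.toContinuousMap.comp ((ContinuousMap.id I).prodMap f),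
    fun x => H.apply_zero (f x), fun x => H.apply_one (f x)⟩, fun t x hx =>
      H.eq_fst t (x := f x) hx⟩⟩

theorem cst_mulMap (f : C(W, Loops X)) : (mulMap (cst W X) f).Homotopic f :=
  let H := HSpace.eHmul (X := Loops X)
  ⟨⟨H.toContinuousMap.comp ((ContinuousMap.id I).prodMap f),
    fun x => H.apply_zero (f x), fun x => H.apply_one (f x)⟩⟩

theorem mulMap_invMap (f : C(W, Loops X)) : (mulMap f (invMap f)).Homotopic (cst W X) :=
  ContinuousMap.Homotopic.symm ⟨⟨Loops.cancel.comp ((ContinuousMap.id I).prodMap f),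
    fun x => Loops.cancel_zero (f x), fun x => Loops.cancel_one (f x)⟩⟩

theorem invMap_invMap (f : C(W, Loops X)) : invMap (invMap f) = f :=
  ContinuousMap.ext fun _ => Path.symm_symm _

instance : Group (LoopClass W X) where
  mul := Quotient.map₂ mulMap fun _ _ hf _ _ hg => mulMap_homotopic hf hg
  one := mk (cst W X)
  inv := Quotient.map invMap fun _ _ h => ContinuousMap.Homotopic.comp (.refl Loops.inv) h
  mul_assoc := by
    rintro ⟨f⟩ ⟨g⟩ ⟨h⟩
    exact Quotient.sound (mulMap_assoc f g h)
  one_mul := by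
    rintro ⟨f⟩
    exact Quotient.sound (cst_mulMap f)
  mul_one := by
    rintro ⟨f⟩
    exact Quotient.sound (mulMap_cst f).homotopic
  inv_mul_cancel := by
    rintro ⟨f⟩
    have h := mulMap_invMap (invMap f)
    rw [invMap_invMap] at h
    exact Quotient.sound h

theorem mk_eq_one_iff {f : C(W, Loops X)} : mk f = 1 ↔ f.Homotopic (cst W X) := mk_eq_iff

/-- The homomorphism induced by a map of the sources. -/
def pull (q : C(W, V)) : LoopClass V X →* LoopClass W X where
  toFun := Quotient.map (fun f => f.comp q) fun _ _ h => ContinuousMap.Homotopic.comp h (.refl q)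
  map_one' := rfl
  map_mul' := by
    rintro ⟨f⟩ ⟨g⟩
    rfl

theorem pull_eq_of_homotopic {q q' : C(W, V)} (h : q.Homotopic q') (x : LoopClass V X) :
    pull q x = pull q' x := by
  induction x using ind with
  | h f => exact mk_eq_iff.2 (.comp (.refl f) h)

theorem pull_pull (q : C(W, V)) (p : C(U, W)) (x : LoopClass V X) :
    pull p (pull q x) = pull (q.comp p) x := by
  induction x using ind with
  | h f => rfl

theorem pull_id (x : LoopClass W X) : pull (ContinuousMap.id W) x = x := by
  induction x using ind with
  | h f => rfl

theorem pull_injective {q : C(W, V)} {p : C(V, W)} (h : (q.comp p).Homotopic (.id V)) :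
    Function.Injective (pull (X := X) q) :=
  Function.LeftInverse.injective (g := pull p) fun x => by
    rw [pull_pull, pull_eq_of_homotopic h, pull_id]

/-- The fibres of `χ` are clopen; restriction to the `i`-th one is replaced by restriction along
any map `s i` that is the identity there. -/
theorem ext_of_discrete {ι : Type*} [TopologicalSpace ι] [DiscreteTopology ι] (χ : C(W, ι))
    (s : ι → C(W, W)) (hs : ∀ w, s (χ w) w = w) {x y : LoopClass W X}
    (h : ∀ i, pull (s i) x = pull (s i) y) : x = y := by
  induction x using ind with | h f =>
  induction y using ind with | h g =>
  let H i := (mk_eq_iff.1 (h i)).some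
  have hH : Continuous fun z : ι × (I × W) => H z.1 z.2 :=
    continuous_prod_of_discrete_left.2 fun i => (H i).continuous
  refine mk_eq_iff.2 ⟨⟨⟨fun z => H (χ z.2) z,
    hH.comp ((χ.continuous.comp continuous_snd).prodMk continuous_id)⟩, fun w => ?_, fun w => ?_⟩⟩
  · exact ((H (χ w)).apply_zero w).trans (congrArg f (hs w))
  · exact ((H (χ w)).apply_one w).trans (congrArg g (hs w))

end LoopClass

/-! ### Deformations into a subspace -/

/-- Deformation data for a subset `F` of `W`: a neighbourhood of `F`, given by a function `u` that
vanishes on `F`, deforms into `F` through maps of `W` that preserve `F`. Since `u` may also vanish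
outside `F` and the points of `F` may move in `F`, this is weaker than being an NDR, and for a base
point it is invariant under pointed homotopy equivalences. -/
structure Halo {W : Type u} [TopologicalSpace W] (F : Set W) where
  /-- a function that vanishes on `F` -/
  u : C(W, I)
  /-- a deformation of `W` that moves the points with `u < 1` into `F` -/
  h : C(I × W, W)
  u_eq : ∀ w ∈ F, u w = 0
  h_zero : ∀ w, h (0, w) = w
  h_one : ∀ w, u w < 1 → h (1, w) ∈ F
  h_mem : ∀ t, ∀ w ∈ F, h (t, w) ∈ F

/-- A retract `F` of `W` with deformation data. -/
structure Face {W : Type u} [TopologicalSpace W] (F : Set W) extends Halo F where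
  /-- the retraction -/
  r : C(W, W)
  r_mem : ∀ w, r w ∈ F
  r_eq : ∀ w ∈ F, r w = w

namespace Halo

variable {W : Type u} [TopologicalSpace W] {F F₁ F₂ : Set W} {Y : Type*} [TopologicalSpace Y]

/-- The end of the deformation. -/
def e (D : Halo F) : C(W, W) := ⟨fun w => D.h (1, w), by fun_prop⟩

/-- The deformation preserves the subset `S`, as is needed to deform two subsets at a time. -/
def Preserves (D : Halo F) (S : Set W) : Prop := ∀ t, ∀ w ∈ S, D.h (t, w) ∈ S

theorem homotopicRel_comp_e (D : Halo F) {S : Set W} (hS : D.Preserves S) {f : C(W, Y)} {y : Y}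
    (hf : ∀ w ∈ S, f w = y) : f.HomotopicRel (f.comp D.e) S :=
  ⟨⟨⟨f.comp D.h, fun w => congrArg f (D.h_zero w), fun _ => rfl⟩, fun t w hw =>
    (hf _ (hS t w hw)).trans (hf w hw).symm⟩⟩

/-- A homotopy extension property: a homotopy `N` whose start is defined by `G` on `F` extends,
after the deformation of `W`, at the cost of being slowed down outside `F`. -/
theorem exists_extension (D : Halo F) {L : Type*} [TopologicalSpace L] (G : C(L × W, Y))
    (N : C(I × (L × W), Y)) (hN : ∀ l, ∀ w ∈ F, N (0, (l, w)) = G (l, w)) :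
    ∃ K : C(L × W, Y), (∀ l, ∀ w ∈ F, K (l, w) = N (1, (l, D.e w))) ∧ ∀ l w,
      K (l, w) = G (l, D.e w) ∨ D.e w ∈ F ∧ ∃ s, K (l, w) = N (s, (l, D.e w)) := by
  let s (w : W) : I := Set.projIcc 0 1 zero_le_one (1 - 2 * (D.u w : ℝ))
  have hs : Continuous s := by fun_prop
  have he {w : W} (hw : (D.u w : ℝ) ≤ 1 / 2) : D.e w ∈ F :=
    D.h_one w (Subtype.coe_lt_coe.1 (hw.trans_lt (by norm_num : (1 / 2 : ℝ) < 1)))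
  let K (z : L × W) : Y :=
    if (D.u z.2 : ℝ) ≤ 1 / 2 then N (s z.2, (z.1, D.e z.2)) else G (z.1, D.e z.2)
  have hK : Continuous K := by
    refine Continuous.if_le (by fun_prop) (by fun_prop) (by fun_prop) continuous_const ?_
    rintro ⟨l, w⟩ (h : (D.u w : ℝ) = 1 / 2)
    have hs0 : s w = 0 := Set.projIcc_of_le_left _ (by linarith)
    rw [hs0, hN l _ (he h.le)]
  refine ⟨⟨K, hK⟩, fun l w hw => ?_, fun l w => ?_⟩
  · have hu : (D.u w : ℝ) = 0 := congrArg Subtype.val (D.u_eq w hw)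
    have hs1 : s w = 1 := Set.projIcc_of_right_le _ (by simp [hu])
    exact (if_pos (by simp [hu])).trans (by rw [hs1])
  · by_cases h : (D.u w : ℝ) ≤ 1 / 2
    · exact Or.inr ⟨he h, s w, if_pos h⟩
    · exact Or.inl (if_neg h)

/-- The deformation of `W` by two deformations in succession. -/
def seqHomotopy (D₁ : Halo F₁) (D₂ : Halo F₂) : C(I × W, W) :=
  ⟨fun z => D₂.h (z.1, D₁.h z), by fun_prop⟩

/-- Deformation data for a union. -/
def union (D₁ : Halo F₁) (D₂ : Halo F₂) (h₁ : D₁.Preserves F₂) (h₂ : D₂.Preserves F₁) :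
    Halo (F₁ ∪ F₂) where
  u := D₁.u ⊓ D₂.u.comp D₁.e
  h := D₁.seqHomotopy D₂
  u_eq w hw := by
    refine le_antisymm ?_ unitInterval.nonneg'
    rcases hw with hw | hw
    · exact inf_le_left.trans (D₁.u_eq w hw).le
    · exact inf_le_right.trans (D₂.u_eq _ (h₁ 1 w hw)).le
  h_zero w := (congrArg (fun w => D₂.h (0, w)) (D₁.h_zero w)).trans (D₂.h_zero w)
  h_one w hw := (min_lt_iff.1 hw).imp (fun h => h₂ 1 _ (D₁.h_one w h)) (D₂.h_one _)
  h_mem t w := Or.imp (fun hw => h₂ t _ (D₁.h_mem t w hw)) (fun hw => D₂.h_mem t _ (h₁ t w hw))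

/-- Deformation data for an intersection. -/
def inter (D₁ : Halo F₁) (D₂ : Halo F₂) (h₁ : D₁.Preserves F₂) (h₂ : D₂.Preserves F₁) :
    Halo (F₁ ∩ F₂) where
  u := D₁.u ⊔ D₂.u.comp D₁.e
  h := D₁.seqHomotopy D₂
  u_eq w hw := le_antisymm (sup_le (D₁.u_eq w hw.1).le (D₂.u_eq _ (h₁ 1 w hw.2)).le)
    unitInterval.nonneg'
  h_zero w := (congrArg (fun w => D₂.h (0, w)) (D₁.h_zero w)).trans (D₂.h_zero w)
  h_one w hw := (max_lt_iff.1 hw).imp (fun h => h₂ 1 _ (D₁.h_one w h)) (D₂.h_one _)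
  h_mem t w := And.imp (fun hw => h₂ t _ (D₁.h_mem t w hw)) (fun hw => D₂.h_mem t _ (h₁ t w hw))

/-- The base point of a quotient `W / S` has deformation data if `S` has. -/
def collapse {W : PSpace.{u}} {S : Set W} (D : Halo S) (hpt : W.pt ∈ S) :
    Halo {(collapse W S).pt} where
  u := ⟨Quot.lift D.u fun x y h => (D.u_eq x h.1).trans (D.u_eq y h.2).symm,
    continuous_quot_lift _ D.u.continuous⟩
  h := ⟨fun z => Quot.lift (fun w => (collapse.mk W S).toMap (D.h (z.1, w)))
      (fun x y h => Quot.sound ⟨D.h_mem _ x h.1, D.h_mem _ y h.2⟩) z.2,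
    IsQuotientMap.continuous_lift_prod_right (f := (collapse.mk W S).toMap) isQuotientMap_quot_mk
      ((collapse.mk W S).toMap.continuous.comp D.h.continuous)⟩
  u_eq := by
    rintro _ rfl
    exact D.u_eq _ hpt
  h_zero := by
    rintro ⟨w⟩
    exact congrArg (collapse.mk W S).toMap (D.h_zero w)
  h_one := by
    rintro ⟨w⟩ hw
    exact Quot.sound ⟨D.h_one w hw, hpt⟩
  h_mem := by
    rintro t _ rfl
    exact Quot.sound ⟨D.h_mem t _ hpt, hpt⟩

end Halo

/-- The base point has deformation data. This is well-pointedness up to pointed homotopy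
equivalence. -/
def HWellPointed (A : PSpace.{u}) : Prop := Nonempty (Halo {A.pt})

theorem hWellPointed_iff {A : PSpace.{u}} : HWellPointed A ↔ ∃ (u : C(A, I)) (e : PMap A A),
    u A.pt = 0 ∧ (PMap.id A).Homotopic e ∧ ∀ a, u a < 1 → e.toMap a = A.pt := by
  constructor
  · rintro ⟨D⟩
    refine ⟨D.u, ⟨D.e, D.h_mem 1 _ rfl⟩, D.u_eq _ rfl, ?_, D.h_one⟩
    exact D.homotopicRel_comp_e D.h_mem (f := .id _) (y := A.pt) fun _ h => h
  · rintro ⟨u, e, hu, ⟨H⟩, he⟩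
    refine ⟨u, H.toContinuousMap, ?_, H.apply_zero, fun a ha => (H.apply_one a).trans (he a ha),
      fun t a ha => (H.eq_fst t ha).trans ha⟩
    rintro _ rfl
    exact hu

theorem WellPointed.hWellPointed {A : PSpace.{u}} (h : WellPointed A) : HWellPointed A := by
  obtain ⟨u, k, hu, hk0, hkpt, hk1⟩ := h
  refine ⟨u, k.comp .prodSwap, fun a => (hu a).2, hk0, hk1, ?_⟩
  rintro t _ rfl
  exact hkpt t

theorem HWellPointed.of_isHEquiv {A B : PSpace.{u}} (hB : HWellPointed B) {f : PMap A B}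
    (hf : IsHEquiv f) : HWellPointed A := by
  obtain ⟨u, e, hu, he, h1⟩ := hWellPointed_iff.1 hB
  obtain ⟨g, hgf, -⟩ := hf
  refine hWellPointed_iff.2 ⟨u.comp f.toMap, g.comp (e.comp f), (congrArg u f.map_pt).trans hu,
    hgf.symm.trans ((he.precomp f).postcomp g), fun a ha => ?_⟩
  exact (congrArg g.toMap (h1 _ ha)).trans g.map_pt

theorem HasCGHType.hWellPointed {A : PSpace.{u}} (h : HasCGHType A) : HWellPointed A := by
  obtain ⟨A', -, -, hA', f, hf⟩ := h
  exact hA'.hWellPointed.of_isHEquiv hf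

/-- The base point as a retract with deformation data. -/
def HWellPointed.face {A : PSpace.{u}} (h : HWellPointed A) : Face {A.pt} where
  toHalo := h.some
  r := ContinuousMap.const A A.pt
  r_mem _ := rfl
  r_eq _ h := h.symm

/-! ### Maps to a loop space that are trivial on a subspace -/

namespace Face

variable {W : Type u} [TopologicalSpace W] {S F : Set W} {X : PSpace.{v}}

theorem exists_homotopic (D : Face F) (hS : D.Preserves S) {g : C(W, Loops X)}
    (hg : ∀ w ∈ S, g w = Path.refl _)
    (hr : (g.comp D.r).HomotopicRel (LoopClass.cst W X) S) :
    ∃ f : C(W, Loops X), (∀ w ∈ S ∪ F, f w = Path.refl _) ∧ g.Homotopic f := by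
  obtain ⟨N⟩ := hr
  obtain ⟨K, hKF, hK⟩ := D.exists_extension (g.comp .snd)
    (N.toContinuousMap.comp ⟨fun z : I × (I × W) => (z.2.1 * z.1, z.2.2), by fun_prop⟩)
    fun t w hw => by
      change N (t * 0, w) = g w
      rw [mul_zero, N.apply_zero, ContinuousMap.comp_apply, D.r_eq w hw]
  refine ⟨⟨fun w => K (1, w), by fun_prop⟩, ?_,
    (D.homotopicRel_comp_e hS hg).homotopic.trans ⟨⟨K, fun w => ?_, fun _ => rfl⟩⟩⟩
  · rintro w (hw | hw)
    · rcases hK 1 w with h | ⟨-, s, h⟩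
      · exact h.trans (hg _ (hS 1 w hw))
      · exact h.trans (N.eq_snd _ (hS 1 w hw))
    · refine (hKF 1 w hw).trans ?_
      change N (1 * 1, D.e w) = _
      rw [one_mul, N.apply_one]
      rfl
  · rcases hK 0 w with h | ⟨hF, s, h⟩
    · exact h
    · refine h.trans ?_
      change N (0 * s, D.e w) = _
      rw [zero_mul, N.apply_zero, ContinuousMap.comp_apply, D.r_eq _ hF]
      rfl

theorem homotopicRel_mulMap_comp_e (D : Face F) (hS : D.Preserves S) {k : C(W, Loops X)}
    (hk : ∀ w ∈ S ∪ F, k w = Path.refl _) :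
    k.HomotopicRel (LoopClass.mulMap (k.comp D.e) (LoopClass.cst W X)) (S ∪ F) := by
  have hSF : D.Preserves (S ∪ F) := fun t w => Or.imp (hS t w) (D.h_mem t w)
  obtain ⟨M⟩ := (LoopClass.mulMap_cst (k.comp D.e)).symm
  exact (D.homotopicRel_comp_e hSF hk).trans
    ⟨⟨M.toHomotopy, fun t w hw => M.eq_fst t (hk _ (hSF 1 w hw))⟩⟩

/-- A homotopy that is trivial on `S` is made trivial on `F` by dividing it by its composite with
the retraction to `F`. The ends that are trivial on `F` change only by a standard homotopy. -/
theorem exists_divided_homotopy (D : Face F) (hS : D.Preserves S) (hr : Set.MapsTo D.r S S)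
    (H : C(I × W, Loops X)) (hHS : ∀ t, ∀ w ∈ S, H (t, w) = Path.refl _) :
    ∃ K : C(I × W, Loops X), (∀ t, ∀ w ∈ S ∪ F, K (t, w) = Path.refl _) ∧
      ∀ t, (∀ w ∈ F, H (t, w) = Path.refl _) →
        ∀ w, K (t, w) = (H (t, D.e w)).trans (Path.refl _) := by
  obtain ⟨K, hKF, hK⟩ := D.exists_extension
    (LoopClass.mulMap H (LoopClass.invMap (H.comp ((ContinuousMap.id I).prodMap D.r))))
    (Loops.cancel.comp ⟨fun z => (σ z.1, H z.2), by fun_prop⟩) fun t w hw => by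
      change Loops.cancel (σ 0, H (t, w)) = (H (t, w)).trans (H (t, D.r w)).symm
      rw [unitInterval.symm_zero, Loops.cancel_one, D.r_eq w hw]
  have heS {w : W} (hw : w ∈ S) : D.e w ∈ S := hS 1 w hw
  refine ⟨K, fun t w hw => ?_, fun t hF w => ?_⟩
  · rcases hw with hw | hw
    · rcases hK t w with h | ⟨-, s, h⟩ <;> refine h.trans ?_
      · change (H (t, D.e w)).trans (H (t, D.r (D.e w))).symm = _
        rw [hHS t _ (heS hw), hHS t _ (hr (heS hw)), Path.refl_symm, Path.refl_trans_refl]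
      · change Loops.cancel (σ s, H (t, D.e w)) = _
        rw [hHS t _ (heS hw), Loops.cancel_refl]
    · refine (hKF t w hw).trans ?_
      change Loops.cancel (σ 1, H (t, D.e w)) = _
      rw [unitInterval.symm_one, Loops.cancel_zero]
  · rcases hK t w with h | ⟨hw, s, h⟩ <;> refine h.trans ?_
    · change (H (t, D.e w)).trans (H (t, D.r (D.e w))).symm = _
      rw [hF _ (D.r_mem _), Path.refl_symm]
    · change Loops.cancel (σ s, H (t, D.e w)) = _
      rw [hF _ hw, Loops.cancel_refl, Path.refl_trans_refl]

theorem homotopicRel (D : Face F) (hS : D.Preserves S) (hr : Set.MapsTo D.r S S)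
    {f g : C(W, Loops X)} (hf : ∀ w ∈ S ∪ F, f w = Path.refl _)
    (hg : ∀ w ∈ S ∪ F, g w = Path.refl _) (hfg : f.HomotopicRel g S) :
    f.HomotopicRel g (S ∪ F) := by
  obtain ⟨H⟩ := hfg
  obtain ⟨K, hK, hend⟩ := D.exists_divided_homotopy hS hr H.toContinuousMap fun t w hw =>
    (H.eq_fst t hw).trans (hf w (Or.inl hw))
  have hK_end (t : I) (k : C(W, Loops X)) (hk : ∀ w ∈ S ∪ F, k w = Path.refl _)
      (hHk : ∀ w, H (t, w) = k w) (w : W) :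
      K (t, w) = LoopClass.mulMap (k.comp D.e) (LoopClass.cst W X) w :=
    (hend t (fun v hv => (hHk v).trans (hk v (Or.inr hv))) w).trans
      (congrArg (Path.trans · (Path.refl _)) (hHk (D.e w)))
  refine (D.homotopicRel_mulMap_comp_e hS hf).trans (.trans
    ⟨⟨⟨K, hK_end 0 f hf H.apply_zero, hK_end 1 g hg H.apply_one⟩, fun t w hw => ?_⟩⟩
    (D.homotopicRel_mulMap_comp_e hS hg).symm)
  exact (hK t w hw).trans ((hK 0 w hw).symm.trans (hK_end 0 f hf H.apply_zero w))

end Face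

/-- The maps `W → ΩX` that are trivial on `S` represent exactly, up to homotopy relative to `S`, the
free homotopy classes that are killed by the self-maps in `R`. So these classes are those of the
quotient `W / S`. In the examples `S` is the union of the images of the retractions in `R`. -/
structure IsRelKernel {W : Type u} [TopologicalSpace W] (X : PSpace.{v}) (S : Set W)
    (R : Set C(W, W)) : Prop where
  homotopicRel : ∀ f g : C(W, Loops X), (∀ w ∈ S, f w = Path.refl _) →
    (∀ w ∈ S, g w = Path.refl _) → f.Homotopic g → f.HomotopicRel g S
  exists_mk_eq : ∀ x : LoopClass W X, (∀ r ∈ R, LoopClass.pull r x = 1) →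
    ∃ f : C(W, Loops X), (∀ w ∈ S, f w = Path.refl _) ∧ LoopClass.mk f = x

namespace IsRelKernel

variable {W : Type u} [TopologicalSpace W] {X : PSpace.{v}} {S F : Set W} {R : Set C(W, W)}

theorem empty : IsRelKernel X (∅ : Set W) ∅ where
  homotopicRel f g _ _ h := ContinuousMap.homotopicRel_empty.2 h
  exists_mk_eq x _ := by
    induction x using LoopClass.ind with
    | h f => exact ⟨f, by simp, rfl⟩

theorem union (h : IsRelKernel X S R) (D : Face F) (hS : D.Preserves S)
    (hr : Set.MapsTo D.r S S) : IsRelKernel X (S ∪ F) (insert D.r R) where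
  homotopicRel f g hf hg hfg := D.homotopicRel hS hr hf hg
    (h.homotopicRel f g (fun w hw => hf w (Or.inl hw)) (fun w hw => hg w (Or.inl hw)) hfg)
  exists_mk_eq x hx := by
    obtain ⟨g, hg, rfl⟩ := h.exists_mk_eq x fun r hr => hx r (Or.inr hr)
    have hgr : (g.comp D.r).HomotopicRel (LoopClass.cst W X) S :=
      h.homotopicRel _ _ (fun w hw => hg _ (hr hw)) (fun _ _ => rfl)
        (LoopClass.mk_eq_one_iff.1 (hx D.r (Or.inl rfl)))
    obtain ⟨f, hf, hgf⟩ := D.exists_homotopic hS hg hgr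
    exact ⟨f, hf, LoopClass.mk_eq_iff.2 hgf.symm⟩

theorem of_face (D : Face F) : IsRelKernel X F {D.r} := by
  have h := (empty (X := X)).union D (fun _ _ h => h.elim) (Set.mapsTo_empty _ _)
  rwa [Set.empty_union, insert_empty_eq] at h

end IsRelKernel

theorem HWellPointed.isRelKernel {A : PSpace.{u}} (hA : HWellPointed A) (X : PSpace.{v}) :
    IsRelKernel X {A.pt} {ContinuousMap.const A A.pt} :=
  .of_face hA.face

/-! ### Products and smash products -/

theorem continuous_prod_of_compactlyGenerated {W : Type u} [TopologicalSpace W]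
    [CompactlyGeneratedSpace W] {L Z : Type*} [TopologicalSpace L] [LocallyCompactSpace L]
    [TopologicalSpace Z] {F : W × L → Z}
    (h : ∀ (S : Type u) [TopologicalSpace S] [CompactSpace S] [T2Space S] (a : S → W),
      Continuous a → Continuous fun z : S × L => F (a z.1, z.2)) :
    Continuous F := by
  have h_slice (w : W) : Continuous fun l => F (w, l) :=
    (h PUnit (fun _ => w) continuous_const).comp (Continuous.prodMk_right PUnit.unit)
  let G (w : W) : C(L, Z) := ⟨fun l => F (w, l), h_slice w⟩
  have hG : Continuous G :=
    continuous_from_compactlyGeneratedSpace G fun S _ _ _ a ha =>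
      ContinuousMap.continuous_of_continuous_uncurry _ (h S a ha)
  exact ContinuousMap.continuous_uncurry_of_continuous ⟨G, hG⟩

namespace kprod

variable {A B A' B' : PSpace.{u}}

theorem continuous_ofProd {S : Type u} [TopologicalSpace S] [CompactSpace S] [T2Space S]
    {a : S → A} {b : S → B} (ha : Continuous a) (hb : Continuous b) :
    Continuous fun s => ofProd A B (a s, b s) :=
  continuous_ofProd_comp (CompHaus.of S) ⟨fun s => (a s, b s), ha.prodMk hb⟩

theorem continuous_mk_right [CompactlyGeneratedSpace B] (a : A) :
    Continuous fun b => ofProd A B (a, b) :=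
  continuous_from_compactlyGeneratedSpace _ fun _ _ _ _ _ hb =>
    continuous_ofProd continuous_const hb

instance : CompactlyGeneratedSpace (kprod A B) :=
  compactlyGeneratedSpace_of_continuous_maps fun f h =>
    continuous_from_compactlyGenerated (X := A.carrier × B.carrier) f fun S g =>
      h S (ofProd A B ∘ g) (continuous_ofProd_comp S g)

theorem continuous_of_compact {L : Type*} [TopologicalSpace L] [LocallyCompactSpace L]
    {Z : Type*} [TopologicalSpace Z] {F : kprod A B × L → Z}
    (h : ∀ (S : Type u) [TopologicalSpace S] [CompactSpace S] [T2Space S] (a : S → A) (b : S → B),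
      Continuous a → Continuous b →
        Continuous fun z : S × L => F (ofProd A B (a z.1, b z.1), z.2)) :
    Continuous F :=
  continuous_prod_of_compactlyGenerated fun S _ _ _ _ hg =>
    h S _ _ ((fst A B).toMap.continuous.comp hg) ((snd A B).toMap.continuous.comp hg)

/-- The product of two homotopies. -/
def mapHomotopy (h : C(I × A, A')) (k : C(I × B, B')) : C(I × kprod A B, kprod A' B') where
  toFun z := ofProd A' B' (h (z.1, (fst A B).toMap z.2), k (z.1, (snd A B).toMap z.2))
  continuous_toFun := by
    have h_swapped : Continuous fun z : kprod A B × I =>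
        ofProd A' B' (h (z.2, (fst A B).toMap z.1), k (z.2, (snd A B).toMap z.1)) :=
      continuous_of_compact fun S _ _ _ a b ha hb =>
        continuous_ofProd (S := S × I) (a := fun z => h (z.2, a z.1))
          (b := fun z => k (z.2, b z.1)) (by fun_prop) (by fun_prop)
    exact h_swapped.comp continuous_swap

/-- The product of two maps, which need not preserve base points. -/
def map (f : C(A, A')) (g : C(B, B')) : C(kprod A B, kprod A' B') :=
  (mapHomotopy (f.comp ContinuousMap.snd) (g.comp ContinuousMap.snd)).comp
    ((ContinuousMap.const _ 0).prodMk (ContinuousMap.id _))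

theorem map_homotopic {f f' : C(A, A')} {g g' : C(B, B')} (hf : f.Homotopic f')
    (hg : g.Homotopic g') : (map f g).Homotopic (map f' g') := by
  obtain ⟨F⟩ := hf
  obtain ⟨G⟩ := hg
  exact ⟨⟨mapHomotopy F.toContinuousMap G.toContinuousMap,
    fun p => Prod.ext (F.apply_zero p.1) (G.apply_zero p.2),
    fun p => Prod.ext (F.apply_one p.1) (G.apply_one p.2)⟩⟩

end kprod

namespace kprod3

variable {A B C A' B' C' : PSpace.{u}}

/-- The product of three maps, which need not preserve base points. -/
def mapMap (f : C(A, A')) (g : C(B, B')) (h : C(C, C')) : C(kprod3 A B C, kprod3 A' B' C') :=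
  kprod.map (kprod.map f g) h

theorem mapMap_homotopic {f f' : C(A, A')} {g g' : C(B, B')} {h h' : C(C, C')}
    (hf : f.Homotopic f') (hg : g.Homotopic g') (hh : h.Homotopic h') :
    (mapMap f g h).Homotopic (mapMap f' g' h') :=
  kprod.map_homotopic (kprod.map_homotopic hf hg) hh

variable (A B C)

/-- The self-map that moves the first coordinate to the base point. -/
def r1 : C(kprod3 A B C, kprod3 A B C) :=
  mapMap (ContinuousMap.const A A.pt) (ContinuousMap.id B) (ContinuousMap.id C)

/-- The self-map that moves the second coordinate to the base point. -/
def r2 : C(kprod3 A B C, kprod3 A B C) :=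
  mapMap (ContinuousMap.id A) (ContinuousMap.const B B.pt) (ContinuousMap.id C)

/-- The self-map that moves the third coordinate to the base point. -/
def r3 : C(kprod3 A B C, kprod3 A B C) :=
  kprod.map (ContinuousMap.id (kprod A B)) (ContinuousMap.const C C.pt)

end kprod3

namespace Halo

variable {A B : PSpace.{u}}

/-- Deformation data for `F × B` in `A × B`. -/
def prodFst {F : Set A} (D : Halo F) (B : PSpace.{u}) : Halo {p : kprod A B | p.1 ∈ F} where
  u := D.u.comp (kprod.fst A B).toMap
  h := kprod.mapHomotopy D.h .snd
  u_eq p := D.u_eq p.1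
  h_zero p := Prod.ext (D.h_zero p.1) rfl
  h_one p := D.h_one p.1
  h_mem t p := D.h_mem t p.1

/-- Deformation data for `A × F` in `A × B`. -/
def prodSnd {F : Set B} (D : Halo F) (A : PSpace.{u}) : Halo {p : kprod A B | p.2 ∈ F} where
  u := D.u.comp (kprod.snd A B).toMap
  h := kprod.mapHomotopy .snd D.h
  u_eq p := D.u_eq p.2
  h_zero p := Prod.ext rfl (D.h_zero p.2)
  h_one p := D.h_one p.2
  h_mem t p := D.h_mem t p.2

end Halo

namespace Face

variable {A B : PSpace.{u}}

/-- The retract `F × B` of `A × B`. -/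
def prodFst {F : Set A} (D : Face F) (B : PSpace.{u}) : Face {p : kprod A B | p.1 ∈ F} where
  toHalo := D.toHalo.prodFst B
  r := kprod.map D.r (ContinuousMap.id B)
  r_mem p := D.r_mem p.1
  r_eq p hp := Prod.ext (D.r_eq p.1 hp) rfl

/-- The retract `A × F` of `A × B`. -/
def prodSnd {F : Set B} (D : Face F) (A : PSpace.{u}) : Face {p : kprod A B | p.2 ∈ F} where
  toHalo := D.toHalo.prodSnd A
  r := kprod.map (ContinuousMap.id A) D.r
  r_mem p := D.r_mem p.2
  r_eq p hp := Prod.ext rfl (D.r_eq p.2 hp)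

end Face

namespace HWellPointed

variable {A B C : PSpace.{u}}

theorem kprod (hA : HWellPointed A) (hB : HWellPointed B) : HWellPointed (kprod A B) := by
  have h := (hA.some.prodFst B).inter (hB.some.prodSnd A) (fun _ _ h => h) (fun _ _ h => h)
  have hpt : {p : Jacobi.kprod A B | p.1 = A.pt} ∩ {p | p.2 = B.pt} = {(Jacobi.kprod A B).pt} :=
    Set.ext fun _ => ⟨fun h => Prod.ext h.1 h.2, by rintro rfl; exact ⟨rfl, rfl⟩⟩
  exact ⟨hpt ▸ h⟩

theorem smash (hA : HWellPointed A) (hB : HWellPointed B) : HWellPointed (smash A B) :=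
  ⟨((hA.some.prodFst B).union (hB.some.prodSnd A) (fun _ _ h => h) (fun _ _ h => h)).collapse
    (Or.inl rfl)⟩

theorem smash3 (hA : HWellPointed A) (hB : HWellPointed B) (hC : HWellPointed C) :
    HWellPointed (smash3 A B C) :=
  ⟨(((hA.some.prodFst B).prodFst C).union
    (((hB.some.prodSnd A).prodFst C).union (hC.some.prodSnd (Jacobi.kprod A B))
      (fun _ _ h => h) (fun _ _ h => h))
    (fun _ _ h => h) (fun _ _ h => h)).collapse (Or.inl rfl)⟩

theorem isRelKernel_fst (hA : HWellPointed A) (B : PSpace.{u}) (X : PSpace.{v}) :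
    IsRelKernel X {p : Jacobi.kprod A B | p.1 = A.pt}
      {kprod.map (ContinuousMap.const A A.pt) (ContinuousMap.id B)} :=
  .of_face (hA.face.prodFst B)

theorem isRelKernel_smash (hA : HWellPointed A) (hB : HWellPointed B) (X : PSpace.{v}) :
    IsRelKernel X {p : Jacobi.kprod A B | p.1 = A.pt ∨ p.2 = B.pt}
      {kprod.map (ContinuousMap.id A) (ContinuousMap.const B B.pt),
        kprod.map (ContinuousMap.const A A.pt) (ContinuousMap.id B)} :=
  (hA.isRelKernel_fst B X).union (hB.face.prodSnd A) (fun _ _ h => h) (fun _ h => h)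

theorem isRelKernel_fatWedge (hA : HWellPointed A) (hB : HWellPointed B) (hC : HWellPointed C)
    (X : PSpace.{v}) :
    IsRelKernel X (fatWedge A B C) {kprod3.r3 A B C, kprod3.r2 A B C, kprod3.r1 A B C} := by
  have h := ((IsRelKernel.of_face (X := X) ((hA.face.prodFst B).prodFst C)).union
    ((hB.face.prodSnd A).prodFst C) (fun _ _ h => h) (fun _ h => h)).union
      (hC.face.prodSnd (Jacobi.kprod A B)) (fun _ _ h => h) (fun _ h => h)
  rwa [Set.union_assoc] at h

end HWellPointed

/-! ### The adjunction between suspensions and loop spaces -/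

theorem PMap.ext {A : PSpace.{u}} {X : PSpace.{v}} {f g : PMap A X}
    (h : ∀ a, f.toMap a = g.toMap a) : f = g := by
  cases f
  cases g
  congr 1
  exact ContinuousMap.ext h

namespace Susp

variable {V : PSpace.{u}} {X : PSpace.{v}}

theorem apply_of_mem_suspEnds (g : PMap V (loopSpace X)) :
    ∀ z ∈ suspEnds V, (g.toMap z.1 : Loops X) z.2 = X.pt := by
  rintro ⟨a, t⟩ ((rfl : a = _) | (rfl : t = _) | (rfl : t = _))
  · exact congrArg (fun p : Loops X => p t) g.map_pt
  · exact (g.toMap a).source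
  · exact (g.toMap a).target

/-- The adjunction between the reduced suspension and the loop space. -/
def adj : PMap (Susp V) X ≃ PMap V (loopSpace X) where
  toFun f :=
    { toMap :=
        { toFun := fun v =>
            { toFun := fun t => f.toMap (mk v t)
              continuous_toFun :=
                f.toMap.continuous.comp ((continuous_mk V).comp (Continuous.prodMk_right v))
              source' := (congrArg f.toMap (mk_eq_pt (Or.inr (Or.inl rfl)))).trans f.map_pt
              target' := (congrArg f.toMap (mk_eq_pt (Or.inr (Or.inr rfl)))).trans f.map_pt }
          continuous_toFun :=
            Path.continuous_uncurry_iff.1 (f.toMap.continuous.comp (continuous_mk V)) }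
      map_pt := Path.ext (funext fun _ =>
        (congrArg f.toMap (mk_eq_pt (Or.inl rfl))).trans f.map_pt) }
  invFun g :=
    have hc : Continuous fun z : V × I => (g.toMap z.1 : Loops X) z.2 :=
      Path.continuous_uncurry_iff.2 g.toMap.continuous
    collapse.lift (A := cyl V) ⟨⟨fun z : V × I => (g.toMap z.1 : Loops X) z.2, hc⟩,
      apply_of_mem_suspEnds g (V.pt, 0) (Or.inl rfl)⟩ (apply_of_mem_suspEnds g)
  left_inv f := PMap.ext (by rintro ⟨z⟩; rfl)
  right_inv g := rfl

theorem adj_homotopic {f g : PMap (Susp V) X} (h : f.Homotopic g) :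
    (adj f).Homotopic (adj g) := by
  obtain ⟨H⟩ := h
  have h_pt (s : I) : H (s, (Susp V).pt) = X.pt := (H.eq_fst s rfl).trans f.map_pt
  let K (z : I × V) : Loops X := (adj ⟨H.curry z.1, h_pt z.1⟩).toMap z.2
  have hK : Continuous K := Path.continuous_uncurry_iff.1 <| H.continuous.comp
    ((by fun_prop : Continuous fun z : (I × V) × I => z.1.1).prodMk
      ((continuous_mk V).comp (by fun_prop : Continuous fun z : (I × V) × I => (z.1.2, z.2))))
  refine ⟨⟨⟨⟨K, hK⟩, fun a => ?_, fun a => ?_⟩, ?_⟩⟩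
  · exact Path.ext (funext fun t => H.apply_zero _)
  · exact Path.ext (funext fun t => H.apply_one _)
  · rintro s _ rfl
    exact (adj ⟨H.curry s, h_pt s⟩).map_pt.trans (adj f).map_pt.symm

theorem adj_symm_homotopic {f g : PMap V (loopSpace X)} (h : f.Homotopic g) :
    (adj.symm f).Homotopic (adj.symm g) := by
  obtain ⟨H⟩ := h
  have hc : Continuous fun z : I × (V × I) => (H (z.1, z.2.1) : Loops X) z.2.2 :=
    (Path.continuous_uncurry_iff.2 H.continuous).comp
      (by fun_prop : Continuous fun z : I × (V × I) => ((z.1, z.2.1), z.2.2))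
  refine collapse.lift_homotopic (apply_of_mem_suspEnds f) (apply_of_mem_suspEnds g)
    ⟨⟨⟨_, hc⟩, fun z => ?_, fun z => ?_⟩, ?_⟩
  · exact congrArg (fun p : Loops X => p z.2) (H.apply_zero z.1)
  · exact congrArg (fun p : Loops X => p z.2) (H.apply_one z.1)
  · rintro s ⟨a, t⟩ hz
    have h_ends : a = V.pt ∨ t = 0 ∨ t = 1 := hz.elim (fun h => Or.inl (congrArg Prod.fst h)) id
    rcases h_ends with rfl | rfl | rfl
    · exact congrArg (fun p : Loops X => p t) (H.eq_fst s (x := V.pt) rfl)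
    · exact (H (s, a)).source.trans (f.toMap a).source.symm
    · exact (H (s, a)).target.trans (f.toMap a).target.symm

theorem adj_homotopic_iff {f g : PMap (Susp V) X} :
    (adj f).Homotopic (adj g) ↔ f.Homotopic g :=
  ⟨fun h => by simpa only [Equiv.symm_apply_apply] using adj_symm_homotopic h, adj_homotopic⟩

theorem adj_desc_comult (f g : PMap (Susp V) X) :
    (adj ((wedge.desc f g).comp (comult V))).toMap =
      LoopClass.mulMap (adj f).toMap (adj g).toMap := by
  ext a t
  change (wedge.desc f g).toMap (comultFun V (a, t)) =
    (((adj f).toMap a : Loops X).trans ((adj g).toMap a)) t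
  rw [Path.trans_apply]
  unfold comultFun
  split_ifs with h
  · refine congrArg (fun s => f.toMap (mk a s)) (Set.projIcc_of_mem _ ⟨?_, ?_⟩)
    · exact mul_nonneg zero_le_two t.2.1
    · dsimp only at h
      linarith
  · refine congrArg (fun s => g.toMap (mk a s)) (Set.projIcc_of_mem _ ⟨?_, ?_⟩)
    · dsimp only at h
      linarith
    · linarith [t.2.2]

end Susp

namespace HClass

variable {V V' : PSpace.{u}} {X : PSpace.{v}}

/-- The free homotopy class of the adjoint map. -/
def toLoops : HClass (Susp V) X → LoopClass V X :=
  Quotient.lift (fun f => LoopClass.mk (Susp.adj f).toMap) fun _ _ h =>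
    LoopClass.mk_eq_iff.2 (Susp.adj_homotopic h).homotopic

theorem toLoops_mul (x y : HClass (Susp V) X) : toLoops (x * y) = toLoops x * toLoops y := by
  induction x using Quotient.ind
  induction y using Quotient.ind
  exact congrArg LoopClass.mk (Susp.adj_desc_comult _ _)

theorem toLoops_inv (x : HClass (Susp V) X) : toLoops x⁻¹ = (toLoops x)⁻¹ := by
  induction x using Quotient.ind
  rfl

theorem toLoops_one : toLoops (1 : HClass (Susp V) X) = 1 := rfl

theorem toLoops_comm (x y : HClass (Susp V) X) :
    toLoops (comm x y) = ⁅toLoops x, toLoops y⁆ := by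
  simp only [comm, toLoops_mul, toLoops_inv, commutatorElement_def]

theorem toLoops_conj (x y : HClass (Susp V) X) :
    toLoops (conj x y) = toLoops y * toLoops x * (toLoops y)⁻¹ := by
  simp only [conj, toLoops_mul, toLoops_inv]

theorem toLoops_pull (f : PMap V V') (x : HClass (Susp V') X) :
    toLoops (x.pull (Susp.map f)) = LoopClass.pull f.toMap (toLoops x) := by
  induction x using Quotient.ind
  rfl

theorem pull_const_toLoops {W : Type*} [TopologicalSpace W] (x : HClass (Susp V) X) :
    LoopClass.pull (ContinuousMap.const W V.pt) (toLoops x) = 1 := by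
  induction x using Quotient.ind with
  | _ f => exact congrArg LoopClass.mk (ContinuousMap.ext fun _ => (Susp.adj f).map_pt)

end HClass

namespace IsRelKernel

variable {W : PSpace.{u}} {X : PSpace.{v}} {S : Set W} {R : Set C(W, W)}

theorem pull_mk_toLoops_injective (h : IsRelKernel X S R) (hpt : W.pt ∈ S) :
    Function.Injective fun ξ : HClass (Susp (collapse W S)) X =>
      LoopClass.pull (collapse.mk W S).toMap ξ.toLoops := by
  intro ξ η hξη
  induction ξ using Quotient.ind with | _ f =>
  induction η using Quotient.ind with | _ g =>
  have h_triv (k : PMap (collapse W S) (loopSpace X)) :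
      ∀ w ∈ S, (k.comp (collapse.mk W S)).toMap w = (loopSpace X).pt := fun w hw =>
    (congrArg k.toMap (Quot.sound ⟨hw, hpt⟩)).trans k.map_pt
  have h_lift (k : PMap (collapse W S) (loopSpace X)) : collapse.lift _ (h_triv k) = k :=
    PMap.ext (by rintro ⟨w⟩; rfl)
  have h_rel : ((Susp.adj f).comp (collapse.mk W S)).toMap.HomotopicRel
      ((Susp.adj g).comp (collapse.mk W S)).toMap (insert W.pt S) := by
    rw [Set.insert_eq_of_mem hpt]
    exact h.homotopicRel _ _ (h_triv _) (h_triv _) (LoopClass.mk_eq_iff.1 hξη)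
  have h_adj := collapse.lift_homotopic (h_triv (Susp.adj f)) (h_triv (Susp.adj g)) h_rel.some
  rw [h_lift, h_lift] at h_adj
  exact Quotient.sound (Susp.adj_homotopic_iff.1 h_adj)

theorem exists_pull_mk_toLoops (h : IsRelKernel X S R) (hpt : W.pt ∈ S) {x : LoopClass W X}
    (hx : ∀ r ∈ R, LoopClass.pull r x = 1) : ∃ ξ : HClass (Susp (collapse W S)) X,
      LoopClass.pull (collapse.mk W S).toMap ξ.toLoops = x := by
  obtain ⟨f, hf, rfl⟩ := h.exists_mk_eq x hx
  let g : PMap (collapse W S) (loopSpace X) := collapse.lift ⟨f, hf _ hpt⟩ hf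
  refine ⟨Quotient.mk _ (Susp.adj.symm g), ?_⟩
  rfl

end IsRelKernel

namespace HWellPointed

variable {V : PSpace.{u}} {X : PSpace.{v}}

theorem toLoops_injective (hV : HWellPointed V) (X : PSpace.{v}) :
    Function.Injective (HClass.toLoops : HClass (Susp V) X → LoopClass V X) := by
  intro ξ η hξη
  induction ξ using Quotient.ind with | _ f =>
  induction η using Quotient.ind with | _ g =>
  refine Quotient.sound (Susp.adj_homotopic_iff.1
    ((hV.isRelKernel X).homotopicRel _ _ ?_ ?_ (LoopClass.mk_eq_iff.1 hξη)))
  · rintro _ rfl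
    exact (Susp.adj f).map_pt
  · rintro _ rfl
    exact (Susp.adj g).map_pt

theorem exists_toLoops_eq (hV : HWellPointed V) {x : LoopClass V X}
    (hx : LoopClass.pull (ContinuousMap.const V V.pt) x = 1) :
    ∃ ξ : HClass (Susp V) X, ξ.toLoops = x := by
  obtain ⟨f, hf, rfl⟩ := (hV.isRelKernel X).exists_mk_eq x (by rintro _ rfl; exact hx)
  exact ⟨Quotient.mk _ (Susp.adj.symm ⟨f, hf _ rfl⟩), rfl⟩

end HWellPointed

/-! ### Fox groups -/

namespace Fox

variable {W V : PSpace.{u}} {X : PSpace.{v}}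

/-- The inclusion of `W` in `W ⊔ *`. -/
def incl (W : PSpace.{u}) : C(W, addPt W) :=
  ⟨(Sum.inl : W.carrier → W.carrier ⊕ PUnit.{u + 1}), continuous_inl⟩

theorem homotopic_of_comp_incl {Y : PSpace.{v}} {f g : PMap (addPt W) Y}
    (h : (f.toMap.comp (incl W)).Homotopic (g.toMap.comp (incl W))) : f.Homotopic g := by
  obtain ⟨H⟩ := h
  let F : W.carrier ⊕ PUnit.{u + 1} → C(I, Y) :=
    Sum.elim (H.toContinuousMap.comp .prodSwap).curry fun _ => ContinuousMap.const I Y.pt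
  have hF : Continuous F := (ContinuousMap.continuous _).sumElim continuous_const
  let K : C((W.carrier ⊕ PUnit.{u + 1}) × I, Y) :=
    ⟨_, ContinuousMap.continuous_uncurry_of_continuous ⟨F, hF⟩⟩
  refine ⟨⟨⟨K.comp .prodSwap, ?_, ?_⟩, ?_⟩⟩
  · rintro (a | ⟨⟩)
    · exact H.apply_zero a
    · exact f.map_pt.symm
  · rintro (a | ⟨⟩)
    · exact H.apply_one a
    · exact g.map_pt.symm
  · rintro t _ rfl
    exact f.map_pt.symm

/-- The restriction to `W` of the adjoint map: the Fox group is the group of free homotopy classes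
of maps from `W` to the loop space. -/
def toLoops (ξ : Fox W X) : LoopClass W X := LoopClass.pull (incl W) (HClass.toLoops ξ)

theorem toLoops_injective : Function.Injective (toLoops : Fox W X → LoopClass W X) := by
  intro ξ η hξη
  induction ξ using Quotient.ind
  induction η using Quotient.ind
  exact Quotient.sound (Susp.adj_homotopic_iff.1
    (homotopic_of_comp_incl (LoopClass.mk_eq_iff.1 hξη)))

theorem toLoops_mul (x y : Fox W X) : toLoops (x * y) = toLoops x * toLoops y := by
  simp only [toLoops, HClass.toLoops_mul, map_mul]

theorem toLoops_inv (x : Fox W X) : toLoops x⁻¹ = (toLoops x)⁻¹ := by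
  simp only [toLoops, HClass.toLoops_inv, map_inv]

theorem toLoops_one : toLoops (1 : Fox W X) = 1 := rfl

theorem toLoops_comm (x y : Fox W X) : toLoops (comm x y) = ⁅toLoops x, toLoops y⁆ := by
  simp only [toLoops, HClass.toLoops_comm, map_commutatorElement]

theorem toLoops_conj (x y : Fox W X) :
    toLoops (conj x y) = toLoops y * toLoops x * (toLoops y)⁻¹ := by
  simp only [toLoops, HClass.toLoops_conj, map_mul, map_inv]

theorem toLoops_image (f : C(W, V)) (ξ : HClass (Susp V) X) :
    toLoops (image f ξ) = LoopClass.pull f ξ.toLoops := by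
  induction ξ using Quotient.ind
  rfl

theorem toLoops_pull (f : C(W, V)) (ξ : Fox V X) :
    toLoops (pull f ξ) = LoopClass.pull f (toLoops ξ) := by
  induction ξ using Quotient.ind
  rfl

end Fox

/-! ### Homotopy co-commutative suspensions -/

theorem Susp.CoCommutative.isMulCommutative {V : PSpace.{u}} (hV : CoCommutative V)
    (X : PSpace.{v}) : IsMulCommutative (HClass (Susp V) X) := by
  refine isMulCommutative_iff.2 fun x y => ?_
  induction x using Quotient.ind with | _ f =>
  induction y using Quotient.ind with | _ g =>
  have h_swap : (wedge.desc f g).comp (wedge.swap (Susp V)) = wedge.desc g f :=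
    PMap.ext (by rintro ⟨z | z⟩ <;> rfl)
  have h : (((wedge.desc f g).comp (wedge.swap (Susp V))).comp (comult V)).Homotopic
      ((wedge.desc f g).comp (comult V)) := hV.postcomp (wedge.desc f g)
  rw [h_swap] at h
  exact Quotient.sound h.symm

/-- The space of maps from `Y` to `X`, pointed by the constant map at the base point; `Y` need not
have a base point. -/
abbrev mapSpace (Y : Type u) [TopologicalSpace Y] (X : PSpace.{v}) : PSpace.{max u v} :=
  ⟨C(Y, X), inferInstance, ContinuousMap.const Y X.pt⟩

namespace LoopClass

section Uncurry

variable {V Y : PSpace.{u}} {X : PSpace.{v}}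

/-- A homotopy of maps from `V` to the loops of `C(Y, X)`, as a homotopy of maps from `V × Y` to
the loops of `X`. -/
def uncurryHomotopy (H : C(I × V, Loops (mapSpace Y X))) : C(I × kprod V Y, Loops X) where
  toFun z :=
    { toFun := fun t => (H (z.1, z.2.1) t : C(Y, X)) z.2.2
      continuous_toFun := (continuous_eval_const z.2.2).comp (H (z.1, z.2.1)).continuous
      source' := congrArg (fun k : C(Y, X) => k z.2.2) (H (z.1, z.2.1)).source
      target' := congrArg (fun k : C(Y, X) => k z.2.2) (H (z.1, z.2.1)).target }
  continuous_toFun := by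
    refine Path.continuous_uncurry_iff.1 ?_
    have hc : Continuous fun z : kprod V Y × (I × I) =>
        (H (z.2.1, z.1.1) z.2.2 : C(Y, X)) z.1.2 :=
      kprod.continuous_of_compact fun S _ _ _ a b ha hb => by
        let K (z : S × (I × I)) : C(S, X) :=
          (H (z.2.1, a z.1) z.2.2 : C(Y, X)).comp ⟨b, hb⟩
        have hH : Continuous fun z : S × (I × I) => (H (z.2.1, a z.1) z.2.2 : C(Y, X)) :=
          (Path.continuous_uncurry_iff.2 H.continuous).comp
            (by fun_prop : Continuous fun z : S × (I × I) => ((z.2.1, a z.1), z.2.2))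
        have hK : Continuous K := (ContinuousMap.continuous_precomp ⟨b, hb⟩).comp hH
        exact hK.eval continuous_fst
    exact hc.comp (by fun_prop : Continuous fun z : (I × kprod V Y) × I => (z.1.2, (z.1.1, z.2)))

/-- A map from `V` to the loops of `C(Y, X)`, as a map from `V × Y` to the loops of `X`. -/
def uncurryMap (f : C(V, Loops (mapSpace Y X))) : C(kprod V Y, Loops X) :=
  (uncurryHomotopy (f.comp ContinuousMap.snd)).comp
    ((ContinuousMap.const _ 0).prodMk (ContinuousMap.id _))

theorem uncurryMap_homotopic {f g : C(V, Loops (mapSpace Y X))} (h : f.Homotopic g) :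
    (uncurryMap f).Homotopic (uncurryMap g) := by
  obtain ⟨H⟩ := h
  refine ⟨⟨uncurryHomotopy H.toContinuousMap, fun z => ?_, fun z => ?_⟩⟩
  · exact Path.ext (funext fun t =>
      congrArg (fun p : Loops (mapSpace Y X) => (p t : C(Y, X)) z.2) (H.apply_zero z.1))
  · exact Path.ext (funext fun t =>
      congrArg (fun p : Loops (mapSpace Y X) => (p t : C(Y, X)) z.2) (H.apply_one z.1))

theorem uncurryMap_mulMap (f g : C(V, Loops (mapSpace Y X))) :
    uncurryMap (mulMap f g) = mulMap (uncurryMap f) (uncurryMap g) := by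
  ext z t
  change (((f z.1).trans (g z.1)) t : C(Y, X)) z.2 =
    ((uncurryMap f z).trans (uncurryMap g z)) t
  rw [Path.trans_apply, Path.trans_apply]
  split_ifs <;> rfl

/-- The homomorphism from the classes of maps to the loops of `C(Y, X)` given by the exponential
law. -/
def uncurry : LoopClass V (mapSpace Y X) →ₙ* LoopClass (kprod V Y) X where
  toFun := Quotient.map uncurryMap fun _ _ => uncurryMap_homotopic
  map_mul' x y := by
    induction x using ind with | h f =>
    induction y using ind with | h g =>
    exact congrArg mk (uncurryMap_mulMap f g)

theorem uncurry_pull {V' : PSpace.{u}} (φ : C(V, V')) (x : LoopClass V' (mapSpace Y X)) :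
    uncurry (pull φ x) = pull (kprod.map φ (ContinuousMap.id Y)) (uncurry x) := by
  induction x using ind with
  | h f => rfl

theorem exists_uncurryMap_eq [CompactlyGeneratedSpace V] [CompactlyGeneratedSpace Y]
    (f : C(kprod V Y, Loops X)) (hf : ∀ p ∈ {p : kprod V Y | p.1 = V.pt}, f p = Path.refl _) :
    ∃ g : PMap V (loopSpace (mapSpace Y X)), uncurryMap g.toMap = f := by
  let k (z : V × I) : C(Y, X) :=
    ⟨fun y => f (kprod.ofProd V Y (z.1, y)) z.2, (continuous_eval_const z.2).comp
      (f.continuous.comp (kprod.continuous_mk_right z.1))⟩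
  have hk : Continuous k := by
    refine continuous_prod_of_compactlyGenerated fun S _ _ _ a ha => ?_
    have h : Continuous fun z : Y × (S × I) => f (kprod.ofProd V Y (a z.2.1, z.1)) z.2.2 :=
      continuous_prod_of_compactlyGenerated fun T _ _ _ b hb =>
        have h_pair : Continuous fun z : T × S => kprod.ofProd V Y (a z.2, b z.1) :=
          kprod.continuous_ofProd (ha.comp continuous_snd) (hb.comp continuous_fst)
        (Path.continuous_uncurry_iff.2 (f.continuous.comp h_pair)).comp
          (by fun_prop : Continuous fun z : T × (S × I) => ((z.1, z.2.1), z.2.2))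
    exact ContinuousMap.continuous_of_continuous_uncurry _ (h.comp continuous_swap)
  let g (v : V) : Loops (mapSpace Y X) :=
    { toFun := fun t => k (v, t)
      continuous_toFun := hk.comp (Continuous.prodMk_right v)
      source' := ContinuousMap.ext fun y => (f (v, y)).source
      target' := ContinuousMap.ext fun y => (f (v, y)).target }
  refine ⟨⟨⟨g, Path.continuous_uncurry_iff.1 hk⟩, Path.ext (funext fun t =>
    ContinuousMap.ext fun y => congrArg (fun p : Loops X => p t) (hf (V.pt, y) rfl))⟩, rfl⟩

end Uncurry

theorem isMulCommutative_ker_pull_of_retract {W W' : Type*} [TopologicalSpace W]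
    [TopologicalSpace W'] {X : PSpace.{v}} {e : C(W, W')} {e' : C(W', W)} {r : C(W, W)}
    {r' : C(W', W')} (he : e'.comp e = .id W) (hr : e'.comp r' = r.comp e')
    (h : IsMulCommutative (pull (X := X) r').ker) : IsMulCommutative (pull (X := X) r).ker := by
  have h_mem {x : LoopClass W X} (hx : x ∈ (pull r).ker) : pull e' x ∈ (pull r').ker := by
    rw [MonoidHom.mem_ker, pull_pull, hr, ← pull_pull, MonoidHom.mem_ker.1 hx, map_one]
  have h_inj : Function.Injective (pull (X := X) e') :=
    pull_injective (p := e) (he ▸ .refl _)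
  refine isMulCommutative_iff.2 fun x y => Subtype.ext (h_inj ?_)
  simpa only [Subgroup.coe_mul, map_mul] using
    congrArg Subtype.val (isMulCommutative_iff.1 h ⟨_, h_mem x.2⟩ ⟨_, h_mem y.2⟩)

end LoopClass

/-- `A` has the pointed homotopy type of a compactly generated space. -/
def HasCGType (A : PSpace.{u}) : Prop :=
  ∃ A' : PSpace.{u}, CompactlyGeneratedSpace A' ∧ ∃ f : PMap A A', IsHEquiv f

theorem HasCGHType.hasCGType {A : PSpace.{u}} (h : HasCGHType A) : HasCGType A :=
  let ⟨A', _, hA', _, hf⟩ := h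
  ⟨A', hA', hf⟩

namespace HWellPointed

variable {V Y : PSpace.{u}} {X : PSpace.{v}}

theorem exists_uncurry_toLoops (hV : HWellPointed V) (hV' : HasCGType V)
    [CompactlyGeneratedSpace Y] {x : LoopClass (Jacobi.kprod V Y) X}
    (hx : LoopClass.pull (kprod.map (.const V V.pt) (.id Y)) x = 1) :
    ∃ ξ : HClass (Susp V) (mapSpace Y X), LoopClass.uncurry ξ.toLoops = x := by
  obtain ⟨V', _, φ, ψ, hψφ, hφψ⟩ := hV'
  have hr : (kprod.map ψ.toMap (.id Y)).comp (kprod.map (.const V' V'.pt) (.id Y)) =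
      (kprod.map (.const V V.pt) (.id Y)).comp (kprod.map ψ.toMap (.id Y)) :=
    ContinuousMap.ext fun _ => Prod.ext ψ.map_pt rfl
  obtain ⟨f, hf, hfx⟩ := ((hV.of_isHEquiv ⟨φ, hφψ, hψφ⟩).isRelKernel_fst Y X).exists_mk_eq
    (LoopClass.pull (kprod.map ψ.toMap (.id Y)) x) (by
      rintro _ rfl
      rw [LoopClass.pull_pull, hr, ← LoopClass.pull_pull, hx, map_one])
  obtain ⟨g, rfl⟩ := LoopClass.exists_uncurryMap_eq f hf
  let ξ : HClass (Susp V') (mapSpace Y X) := Quotient.mk _ (Susp.adj.symm g)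
  have h_retract : ((kprod.map ψ.toMap (.id Y)).comp (kprod.map φ.toMap (.id Y))).Homotopic
      (.id (Jacobi.kprod V Y)) :=
    kprod.map_homotopic hψφ.homotopic (.refl (.id Y))
  refine ⟨ξ.pull (Susp.map φ), ?_⟩
  calc LoopClass.uncurry (ξ.pull (Susp.map φ)).toLoops
      = LoopClass.pull (kprod.map φ.toMap (.id Y)) (LoopClass.uncurry ξ.toLoops) := by
        rw [HClass.toLoops_pull, LoopClass.uncurry_pull]
    _ = LoopClass.pull (kprod.map φ.toMap (.id Y)) (LoopClass.pull (kprod.map ψ.toMap (.id Y)) x) :=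
        congrArg _ hfx
    _ = x := by
        rw [LoopClass.pull_pull, LoopClass.pull_eq_of_homotopic h_retract, LoopClass.pull_id]

end HWellPointed

/-- If `ΣV` is homotopy co-commutative, then `[ΣV, C(Y, X)]` is commutative, and it maps onto the
kernel of the restriction from `V × Y` to `* × Y`. -/
theorem Susp.CoCommutative.isMulCommutative_ker_fst {V : PSpace.{u}} (hc : CoCommutative V)
    (hV : HWellPointed V) (hV' : HasCGType V) (Y : PSpace.{u}) [CompactlyGeneratedSpace Y]
    (X : PSpace.{v}) :
    IsMulCommutative (LoopClass.pull (X := X)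
      (kprod.map (ContinuousMap.const V V.pt) (ContinuousMap.id Y))).ker := by
  refine isMulCommutative_iff.2 fun ⟨x, hx⟩ ⟨y, hy⟩ => Subtype.ext ?_
  obtain ⟨ξ, rfl⟩ := hV.exists_uncurry_toLoops hV' hx
  obtain ⟨η, rfl⟩ := hV.exists_uncurry_toLoops hV' hy
  have h_comm : ξ * η = η * ξ := isMulCommutative_iff.1 (hc.isMulCommutative _) ξ η
  change LoopClass.uncurry ξ.toLoops * LoopClass.uncurry η.toLoops =
    LoopClass.uncurry η.toLoops * LoopClass.uncurry ξ.toLoops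
  rw [← map_mul, ← map_mul, ← HClass.toLoops_mul, ← HClass.toLoops_mul, h_comm]

namespace Susp.CoCommutative

variable {A B C : PSpace.{u}}

theorem isMulCommutative_ker_r1 (hc : CoCommutative A) (hA : HWellPointed A)
    (hA' : HasCGType A) (B C : PSpace.{u}) (X : PSpace.{v}) :
    IsMulCommutative (LoopClass.pull (X := X) (kprod3.r1 A B C)).ker := by
  let e : PMap (kprod3 A B C) (kprod A (kprod B C)) :=
    kprod.pair (kprod3.p1 A B C) (kprod.pair (kprod3.p2 A B C) (kprod3.p3 A B C))
  let e' : PMap (kprod A (kprod B C)) (kprod3 A B C) :=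
    kprod.pair (kprod.pair (kprod.fst _ _) ((kprod.fst B C).comp (kprod.snd _ _)))
      ((kprod.snd B C).comp (kprod.snd _ _))
  exact LoopClass.isMulCommutative_ker_pull_of_retract (e := e.toMap) (e' := e'.toMap) rfl rfl
    (hc.isMulCommutative_ker_fst hA hA' (kprod B C) X)

theorem isMulCommutative_ker_r2 (hc : CoCommutative B) (hB : HWellPointed B)
    (hB' : HasCGType B) (A C : PSpace.{u}) (X : PSpace.{v}) :
    IsMulCommutative (LoopClass.pull (X := X) (kprod3.r2 A B C)).ker :=
  LoopClass.isMulCommutative_ker_pull_of_retract (e := (kprod3.t213 A B C).toMap)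
    (e' := (kprod3.t213 B A C).toMap) rfl rfl (hc.isMulCommutative_ker_r1 hB hB' A C X)

theorem isMulCommutative_ker_r3 (hc : CoCommutative C) (hC : HWellPointed C)
    (hC' : HasCGType C) (A B : PSpace.{u}) (X : PSpace.{v}) :
    IsMulCommutative (LoopClass.pull (X := X) (kprod3.r3 A B C)).ker :=
  LoopClass.isMulCommutative_ker_pull_of_retract (e := (kprod3.t321 A B C).toMap)
    (e' := (kprod3.t321 C B A).toMap) rfl rfl (hc.isMulCommutative_ker_r1 hC hC' B A X)

end Susp.CoCommutative

/-! ### Generalized Whitehead products and the action of the fundamental group -/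

section GeneralizedWhiteheadProduct

variable {A B : PSpace.{u}} {X : PSpace.{v}}

theorem isGWP_iff (hA : HWellPointed A) (hB : HWellPointed B) {ξ : HClass (Susp A) X}
    {η : HClass (Susp B) X} {κ : HClass (Susp (smash A B)) X} :
    IsGWP ξ η κ ↔ LoopClass.pull (smash.proj A B).toMap κ.toLoops =
      ⁅LoopClass.pull (kprod.fst A B).toMap ξ.toLoops,
        LoopClass.pull (kprod.snd A B).toMap η.toLoops⁆ := by
  rw [IsGWP, ← ((hA.kprod hB).toLoops_injective X).eq_iff]
  simp only [HClass.toLoops_comm, HClass.toLoops_pull]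

theorem existsUnique_isGWP (hA : HWellPointed A) (hB : HWellPointed B) (ξ : HClass (Susp A) X)
    (η : HClass (Susp B) X) : ∃! κ, IsGWP ξ η κ := by
  simp only [isGWP_iff hA hB]
  have h := hA.isRelKernel_smash hB X
  have hpt : (kprod A B).pt ∈ {p : kprod A B | p.1 = A.pt ∨ p.2 = B.pt} := Or.inl rfl
  refine existsUnique_of_exists_of_unique (h.exists_pull_mk_toLoops hpt ?_)
    fun κ κ' hκ hκ' => h.pull_mk_toLoops_injective hpt (hκ.trans hκ'.symm)
  rintro _ (rfl | rfl) <;> rw [map_commutatorElement, LoopClass.pull_pull, LoopClass.pull_pull]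
  · have hη : LoopClass.pull ((kprod.snd A B).toMap.comp (kprod.map (.id A) (.const B B.pt)))
        η.toLoops = 1 := η.pull_const_toLoops
    rw [hη, commutatorElement_one_right]
  · have hξ : LoopClass.pull ((kprod.fst A B).toMap.comp (kprod.map (.const A A.pt) (.id B)))
        ξ.toLoops = 1 := ξ.pull_const_toLoops
    rw [hξ, commutatorElement_one_left]

theorem pull_proj_toLoops_gwp (hA : HWellPointed A) (hB : HWellPointed B)
    (ξ : HClass (Susp A) X) (η : HClass (Susp B) X) :
    LoopClass.pull (smash.proj A B).toMap (gwp ξ η).toLoops =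
      ⁅LoopClass.pull (kprod.fst A B).toMap ξ.toLoops,
        LoopClass.pull (kprod.snd A B).toMap η.toLoops⁆ :=
  (isGWP_iff hA hB).1 (Classical.epsilon_spec (existsUnique_isGWP hA hB ξ η).exists)

end GeneralizedWhiteheadProduct

section Action

/-- The point of `S⁰` other than the base point. -/
def S0.other : S0.{u} := (ULift.up true : ULift.{u} Bool)

variable {W : PSpace.{u}} {X : PSpace.{v}}

theorem isAction_iff {ω : HClass (Susp S0.{u}) X} {η θ : HClass (Susp W) X} :
    IsAction ω η θ ↔ θ.toLoops =
      LoopClass.pull (.const W S0.other) ω.toLoops * η.toLoops *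
        (LoopClass.pull (.const W S0.other) ω.toLoops)⁻¹ := by
  rw [IsAction, ← Fox.toLoops_injective.eq_iff, Fox.toLoops_conj, piOneImage]
  simp only [Fox.toLoops_image, LoopClass.pull_id]
  rfl

theorem existsUnique_isAction (hW : HWellPointed W) (ω : HClass (Susp S0.{u}) X)
    (η : HClass (Susp W) X) : ∃! θ, IsAction ω η θ := by
  simp only [isAction_iff]
  refine existsUnique_of_exists_of_unique (hW.exists_toLoops_eq ?_)
    fun θ θ' hθ hθ' => hW.toLoops_injective X (hθ.trans hθ'.symm)
  rw [map_mul, map_mul, η.pull_const_toLoops, mul_one, map_inv, mul_inv_cancel]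

theorem toLoops_action (hW : HWellPointed W) (ω : HClass (Susp S0.{u}) X)
    (η : HClass (Susp W) X) : (action ω η).toLoops =
      LoopClass.pull (.const W S0.other) ω.toLoops * η.toLoops *
        (LoopClass.pull (.const W S0.other) ω.toLoops)⁻¹ :=
  isAction_iff.1 (Classical.epsilon_spec (existsUnique_isAction hW ω η).exists)

end Action

namespace smash3

variable {A B C : PSpace.{u}} {X : PSpace.{v}}

/-- The image of a class of maps of `Σ(A ∧ B ∧ C)` in the classes of maps of `A × B × C` to the
loop space, where the generalized Whitehead products become commutators. -/
def toLoops (η : HClass (Susp (smash3 A B C)) X) : LoopClass (kprod3 A B C) X :=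
  LoopClass.pull (proj A B C).toMap η.toLoops

theorem toLoops_injective (hA : HWellPointed A) (hB : HWellPointed B) (hC : HWellPointed C)
    (X : PSpace.{v}) :
    Function.Injective (toLoops : HClass (Susp (smash3 A B C)) X → LoopClass (kprod3 A B C) X) :=
  (hA.isRelKernel_fatWedge hB hC X).pull_mk_toLoops_injective (Or.inl rfl)

theorem toLoops_mul (x y : HClass (Susp (smash3 A B C)) X) :
    toLoops (x * y) = toLoops x * toLoops y := by
  simp only [toLoops, HClass.toLoops_mul, map_mul]

theorem toLoops_pull_map {D E F : PSpace.{u}} (t : PMap (kprod3 A B C) (kprod3 D E F))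
    (ht : ∀ x ∈ fatWedge A B C, t.toMap x ∈ fatWedge D E F) (η : HClass (Susp (smash3 D E F)) X) :
    toLoops (η.pull (Susp.map (map t ht))) = LoopClass.pull t.toMap (toLoops η) := by
  simp only [toLoops, HClass.toLoops_pull, LoopClass.pull_pull]
  rfl

theorem pull_r1_toLoops (η : HClass (Susp (smash3 A B C)) X) :
    LoopClass.pull (kprod3.r1 A B C) (toLoops η) = 1 := by
  have h : (proj A B C).toMap.comp (kprod3.r1 A B C) = .const _ (smash3 A B C).pt :=
    ContinuousMap.ext fun _ => Quot.sound ⟨Or.inl rfl, Or.inl rfl⟩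
  rw [toLoops, LoopClass.pull_pull, h, η.pull_const_toLoops]

theorem toLoops_gwp3 (hA : HWellPointed A) (hB : HWellPointed B) (hC : HWellPointed C)
    (ξ : HClass (Susp A) X) (η : HClass (Susp B) X) (ζ : HClass (Susp C) X) :
    toLoops (gwp3 ξ η ζ) =
      ⁅⁅LoopClass.pull (kprod3.p1 A B C).toMap ξ.toLoops,
        LoopClass.pull (kprod3.p2 A B C).toMap η.toLoops⁆,
        LoopClass.pull (kprod3.p3 A B C).toMap ζ.toLoops⁆ := by
  let m : PMap (kprod3 A B C) (kprod (smash A B) C) :=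
    kprod.pair ((smash.proj A B).comp (kprod.fst (kprod A B) C)) (kprod.snd (kprod A B) C)
  have h_outer : toLoops (gwp3 ξ η ζ) = LoopClass.pull m.toMap
      (LoopClass.pull (smash.proj (smash A B) C).toMap (gwp (gwp ξ η) ζ).toLoops) := by
    rw [toLoops, gwp3, HClass.toLoops_pull, LoopClass.pull_pull, LoopClass.pull_pull]
    rfl
  have h_inner : LoopClass.pull m.toMap (LoopClass.pull (kprod.fst (smash A B) C).toMap
      (gwp ξ η).toLoops) = LoopClass.pull (kprod.fst (kprod A B) C).toMap
        (LoopClass.pull (smash.proj A B).toMap (gwp ξ η).toLoops) := by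
    rw [LoopClass.pull_pull, LoopClass.pull_pull]
    rfl
  rw [h_outer, pull_proj_toLoops_gwp (hA.smash hB) hC, map_commutatorElement, h_inner,
    pull_proj_toLoops_gwp hA hB, map_commutatorElement, LoopClass.pull_pull, LoopClass.pull_pull,
    LoopClass.pull_pull]
  rfl

theorem pull_toLoops_gwp3 {D E F : PSpace.{u}} (t : PMap (kprod3 A B C) (kprod3 D E F))
    (hD : HWellPointed D) (hE : HWellPointed E) (hF : HWellPointed F)
    (ξ : HClass (Susp D) X) (η : HClass (Susp E) X) (ζ : HClass (Susp F) X) :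
    LoopClass.pull t.toMap (toLoops (gwp3 ξ η ζ)) =
      ⁅⁅LoopClass.pull ((kprod3.p1 D E F).comp t).toMap ξ.toLoops,
        LoopClass.pull ((kprod3.p2 D E F).comp t).toMap η.toLoops⁆,
        LoopClass.pull ((kprod3.p3 D E F).comp t).toMap ζ.toLoops⁆ := by
  simp only [toLoops_gwp3 hD hE hF, map_commutatorElement, LoopClass.pull_pull]
  rfl

end smash3

theorem Fox.pull_image_gwp3 {W D E F : PSpace.{u}} {X : PSpace.{v}} (t : C(W, kprod3 D E F))
    (hD : HWellPointed D) (hE : HWellPointed E) (hF : HWellPointed F)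
    (ξ : HClass (Susp D) X) (η : HClass (Susp E) X) (ζ : HClass (Susp F) X) :
    pull t (image (smash3.proj D E F).toMap (gwp3 ξ η ζ)) =
      comm (comm (image ((kprod3.p1 D E F).toMap.comp t) ξ)
        (image ((kprod3.p2 D E F).toMap.comp t) η)) (image ((kprod3.p3 D E F).toMap.comp t) ζ) := by
  have h := congrArg (LoopClass.pull t) (smash3.toLoops_gwp3 hD hE hF ξ η ζ)
  apply toLoops_injective
  simpa only [smash3.toLoops, toLoops_pull, toLoops_image, toLoops_comm, map_commutatorElement,
    LoopClass.pull_pull] using h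

theorem Fox.image_inv {W V : PSpace.{u}} {X : PSpace.{v}} (f : C(W, V)) (ξ : HClass (Susp V) X) :
    image f ξ⁻¹ = (image f ξ)⁻¹ := by
  apply toLoops_injective
  simp only [toLoops_image, toLoops_inv, HClass.toLoops_inv, map_inv]

instance : DiscreteTopology S0.{u} := ⟨rfl⟩

/-- On the two pieces of `S⁰ × D × E`, either the classes that are compared are both trivial, or
the elements by which `y` is conjugated agree. -/
theorem kprod3.conj_eq_of_isHEquiv {V D E : PSpace.{u}} {X : PSpace.{v}} {s : PMap S0.{u} V}
    (hs : IsHEquiv s) (ξ : HClass (Susp V) X) {y : LoopClass (kprod3 V D E) X}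
    (hy : LoopClass.pull (r1 V D E) y = 1) :
    LoopClass.pull (p1 V D E).toMap ξ.toLoops * y *
        (LoopClass.pull (p1 V D E).toMap ξ.toLoops)⁻¹ =
      LoopClass.pull (.const _ (s.toMap S0.other)) ξ.toLoops * y *
        (LoopClass.pull (.const _ (s.toMap S0.other)) ξ.toLoops)⁻¹ := by
  obtain ⟨s', -, hs'⟩ := hs
  let m : C(kprod3 S0 D E, kprod3 V D E) := mapMap s.toMap (.id D) (.id E)
  let m' : C(kprod3 V D E, kprod3 S0 D E) := mapMap s'.toMap (.id D) (.id E)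
  have hm : (m.comp m').Homotopic (.id _) :=
    mapMap_homotopic hs'.homotopic (.refl (.id D)) (.refl (.id E))
  refine LoopClass.pull_injective hm <| LoopClass.ext_of_discrete (p1 S0 D E).toMap
    (fun b => mapMap (.const S0 b) (.id D) (.id E)) (fun _ => rfl) ?_
  rintro ⟨_ | _⟩
  · have h_comp : m.comp (mapMap (.const S0 S0.pt) (.id D) (.id E)) = (r1 V D E).comp m :=
      ContinuousMap.ext fun _ => Prod.ext (Prod.ext s.map_pt rfl) rfl
    have hy' : LoopClass.pull (mapMap (.const S0 S0.pt) (.id D) (.id E))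
        (LoopClass.pull m y) = 1 := by
      rw [LoopClass.pull_pull, h_comp, ← LoopClass.pull_pull, hy, map_one]
    change LoopClass.pull (mapMap (.const S0 S0.pt) (.id D) (.id E)) _ =
      LoopClass.pull (mapMap (.const S0 S0.pt) (.id D) (.id E)) _
    simp only [map_mul, map_inv, hy', mul_one, mul_inv_cancel]
  · simp only [map_mul, map_inv, LoopClass.pull_pull]
    rfl

theorem kprod3.pull_r1_pull_p1_toLoops {A B C : PSpace.{u}} {X : PSpace.{v}}
    (ξ : HClass (Susp A) X) :
    LoopClass.pull (r1 A B C) (LoopClass.pull (p1 A B C).toMap ξ.toLoops) = 1 :=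
  (LoopClass.pull_pull _ _ _).trans ξ.pull_const_toLoops

theorem smash3.toLoops_dot {A B C : PSpace.{u}} {X : PSpace.{v}} (hA : HWellPointed A)
    (hA' : HasCGType A) (hB : HWellPointed B) (hC : HWellPointed C)
    (h : Susp.CoCommutative A ∨ ∃ s : PMap S0.{u} A, IsHEquiv s) (ξ : HClass (Susp A) X)
    (η : HClass (Susp (smash3 A B C)) X) :
    toLoops (dot ξ η) = LoopClass.pull (kprod3.p1 A B C).toMap ξ.toLoops * toLoops η *
      (LoopClass.pull (kprod3.p1 A B C).toMap ξ.toLoops)⁻¹ := by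
  unfold dot
  split_ifs with hs
  · rw [kprod3.conj_eq_of_isHEquiv hs.choose_spec ξ (pull_r1_toLoops η), toLoops,
      toLoops_action (hA.smash3 hB hC), HClass.toLoops_pull, map_mul, map_mul, map_inv,
      LoopClass.pull_pull, LoopClass.pull_pull]
    rfl
  · have h_comm := isMulCommutative_iff.1
      ((h.resolve_right hs).isMulCommutative_ker_r1 hA hA' B C X)
      ⟨_, kprod3.pull_r1_pull_p1_toLoops ξ⟩ ⟨_, pull_r1_toLoops η⟩
    exact eq_mul_inv_of_mul_eq (congrArg Subtype.val h_comm).symm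

/-! ### The Jacobi identities -/

section HallWitt

variable {G : Type*} [Group G] {a b c : G}

theorem hall_witt (a b c : G) :
    b * ⁅⁅b⁻¹, a⁆, c⁆ * b⁻¹ * (c * ⁅⁅c⁻¹, b⁆, a⁆ * c⁻¹) * (a * ⁅⁅a⁻¹, c⁆, b⁆ * a⁻¹) = 1 := by
  simp only [commutatorElement_def]
  group

theorem commutatorElement_mem_of_mem_left {N : Subgroup G} [hN : N.Normal] (ha : a ∈ N) (b : G) :
    ⁅a, b⁆ ∈ N := by
  have h : ⁅a, b⁆ = a * (b * a⁻¹ * b⁻¹) := by simp only [commutatorElement_def, mul_assoc]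
  exact h ▸ mul_mem ha (hN.conj_mem _ (inv_mem ha) b)

theorem commutatorElement_mem_of_mem_right {N : Subgroup G} [N.Normal] (hb : b ∈ N) (a : G) :
    ⁅a, b⁆ ∈ N :=
  commutatorElement_inv b a ▸ inv_mem (commutatorElement_mem_of_mem_left hb a)

theorem conj_commutatorElement_inv {N : Subgroup G} [N.Normal] (hN : IsMulCommutative N)
    (ha : a ∈ N) (b c : G) : a * ⁅⁅a⁻¹, b⁆, c⁆ * a⁻¹ = ⁅⁅b, a⁆, c⁆ := by
  have h_comm {x : G} (hx : x ∈ N) : a * x = x * a :=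
    congrArg Subtype.val (isMulCommutative_iff.1 hN ⟨a, ha⟩ ⟨x, hx⟩)
  have hba : ⁅b, a⁆ ∈ N := commutatorElement_mem_of_mem_right ha b
  have h_inv : ⁅a⁻¹, b⁆ = ⁅b, a⁆ :=
    calc ⁅a⁻¹, b⁆ = a⁻¹ * (⁅b, a⁆ * a) := by simp only [commutatorElement_def]; group
      _ = ⁅b, a⁆ := by rw [← h_comm hba, inv_mul_cancel_left]
  rw [h_inv, h_comm (commutatorElement_mem_of_mem_left hba c), mul_inv_cancel_right]

theorem jacobi_of_mem_normal {N₁ N₂ N₃ : Subgroup G} [N₁.Normal] [N₂.Normal] [N₃.Normal]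
    (h₁ : IsMulCommutative N₁) (h₂ : IsMulCommutative N₂) (h₃ : IsMulCommutative N₃)
    (ha : a ∈ N₁) (hb : b ∈ N₂) (hc : c ∈ N₃) :
    ⁅⁅a, b⁆, c⁆ * ⁅⁅c, a⁆, b⁆ * ⁅⁅b, c⁆, a⁆ = 1 := by
  have hca : ⁅⁅c, a⁆, b⁆ ∈ N₃ :=
    commutatorElement_mem_of_mem_left (commutatorElement_mem_of_mem_left hc a) b
  have hbc : ⁅⁅b, c⁆, a⁆ ∈ N₃ :=
    commutatorElement_mem_of_mem_left (commutatorElement_mem_of_mem_right hc b) a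
  have h_comm : ⁅⁅c, a⁆, b⁆ * ⁅⁅b, c⁆, a⁆ = ⁅⁅b, c⁆, a⁆ * ⁅⁅c, a⁆, b⁆ :=
    congrArg Subtype.val (isMulCommutative_iff.1 h₃ ⟨_, hca⟩ ⟨_, hbc⟩)
  rw [mul_assoc, h_comm, ← mul_assoc, ← conj_commutatorElement_inv h₂ hb a c,
    ← conj_commutatorElement_inv h₃ hc b a, ← conj_commutatorElement_inv h₁ ha c b, hall_witt]

end HallWitt

theorem Fox.hall_witt {W : PSpace.{u}} {X : PSpace.{v}} (a b c : Fox W X) :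
    conj (comm (comm b⁻¹ a) c) b * conj (comm (comm c⁻¹ b) a) c *
      conj (comm (comm a⁻¹ c) b) a = 1 := by
  apply toLoops_injective
  simp only [toLoops_mul, toLoops_conj, toLoops_comm, toLoops_inv, toLoops_one, Jacobi.hall_witt]

section JacobiIdentity

variable {A B C : PSpace.{u}} {X : PSpace.{v}}

theorem gwp3_jacobi (hA : HWellPointed A) (hB : HWellPointed B) (hC : HWellPointed C)
    (hA' : HasCGType A) (hB' : HasCGType B) (hC' : HasCGType C) (hcA : Susp.CoCommutative A)
    (hcB : Susp.CoCommutative B) (hcC : Susp.CoCommutative C) (α : HClass (Susp A) X)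
    (β : HClass (Susp B) X) (γ : HClass (Susp C) X) :
    gwp3 α β γ * (gwp3 γ α β).pull (Susp.map (smash3.t312 A B C)) *
      (gwp3 β γ α).pull (Susp.map (smash3.t231 A B C)) = 1 := by
  apply smash3.toLoops_injective hA hB hC X
  simp only [smash3.toLoops_mul, smash3.t312, smash3.t231, smash3.toLoops_pull_map,
    smash3.pull_toLoops_gwp3 _ hC hA hB, smash3.pull_toLoops_gwp3 _ hB hC hA,
    smash3.toLoops_gwp3 hA hB hC]
  exact jacobi_of_mem_normal (hcA.isMulCommutative_ker_r1 hA hA' B C X)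
    (hcB.isMulCommutative_ker_r2 hB hB' A C X) (hcC.isMulCommutative_ker_r3 hC hC' A B X)
    ((LoopClass.pull_pull _ _ _).trans α.pull_const_toLoops)
    ((LoopClass.pull_pull _ _ _).trans β.pull_const_toLoops)
    ((LoopClass.pull_pull _ _ _).trans γ.pull_const_toLoops)

theorem smash3.toLoops_dot_gwp3 (hA : HWellPointed A) (hB : HWellPointed B) (hC : HWellPointed C)
    (hA' : HasCGType A) (h : Susp.CoCommutative A ∨ ∃ s : PMap S0.{u} A, IsHEquiv s)
    (α : HClass (Susp A) X) (β : HClass (Susp B) X) (γ : HClass (Susp C) X) :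
    toLoops (dot α (gwp3 α⁻¹ β γ)) =
      LoopClass.pull (kprod3.p1 A B C).toMap α.toLoops *
        ⁅⁅(LoopClass.pull (kprod3.p1 A B C).toMap α.toLoops)⁻¹,
          LoopClass.pull (kprod3.p2 A B C).toMap β.toLoops⁆,
          LoopClass.pull (kprod3.p3 A B C).toMap γ.toLoops⁆ *
        (LoopClass.pull (kprod3.p1 A B C).toMap α.toLoops)⁻¹ := by
  rw [toLoops_dot hA hA' hB hC h, toLoops_gwp3 hA hB hC, HClass.toLoops_inv, map_inv]

theorem dot_gwp3_jacobi (hA : HWellPointed A) (hB : HWellPointed B) (hC : HWellPointed C)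
    (hA' : HasCGType A) (hB' : HasCGType B) (hC' : HasCGType C)
    (hcA : Susp.CoCommutative A ∨ ∃ s : PMap S0.{u} A, IsHEquiv s)
    (hcB : Susp.CoCommutative B ∨ ∃ s : PMap S0.{u} B, IsHEquiv s)
    (hcC : Susp.CoCommutative C ∨ ∃ s : PMap S0.{u} C, IsHEquiv s) (α : HClass (Susp A) X)
    (β : HClass (Susp B) X) (γ : HClass (Susp C) X) :
    (dot β (gwp3 β⁻¹ α γ)).pull (Susp.map (smash3.t213 A B C)) *
      (dot γ (gwp3 γ⁻¹ β α)).pull (Susp.map (smash3.t321 A B C)) *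
      (dot α (gwp3 α⁻¹ γ β)).pull (Susp.map (smash3.t132 A B C)) = 1 := by
  apply smash3.toLoops_injective hA hB hC X
  simp only [smash3.toLoops_mul, smash3.t213, smash3.t321, smash3.t132, smash3.toLoops_pull_map,
    smash3.toLoops_dot_gwp3 hB hA hC hB' hcB, smash3.toLoops_dot_gwp3 hC hB hA hC' hcC,
    smash3.toLoops_dot_gwp3 hA hC hB hA' hcA, map_mul, map_inv, map_commutatorElement,
    LoopClass.pull_pull]
  exact hall_witt (LoopClass.pull (kprod3.p1 A B C).toMap α.toLoops)
    (LoopClass.pull (kprod3.p2 A B C).toMap β.toLoops)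
    (LoopClass.pull (kprod3.p3 A B C).toMap γ.toLoops)

end JacobiIdentity

end Jacobi

end

open Jacobi in
theorem theorem3_general (A B C : PSpace.{u}) (X : PSpace.{v})
    (hA : HWellPointed A) (hB : HWellPointed B) (hC : HWellPointed C)
    (α : HClass (Susp A) X) (β : HClass (Susp B) X) (γ : HClass (Susp C) X) :
    ((∃! κ, IsGWP α β κ) ∧ (∀ κ : HClass (Susp (smash A B)) X, ∃! μ, IsGWP κ γ μ) ∧
      (∀ (ω : HClass (Susp S0.{u}) X) (η : HClass (Susp (smash3 A B C)) X),
        ∃! θ, IsAction ω η θ)) ∧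
    (∀ a b c : Fox (kprod3 A B C) X,
      a = Fox.image (kprod3.p1 A B C).toMap α →
      b = Fox.image (kprod3.p2 A B C).toMap β →
      c = Fox.image (kprod3.p3 A B C).toMap γ →
      Fox.pull (kprod3.t213 A B C).toMap
          (Fox.image (smash3.proj B A C).toMap (gwp3 β⁻¹ α γ)) = comm (comm b⁻¹ a) c ∧
      Fox.pull (kprod3.t321 A B C).toMap
          (Fox.image (smash3.proj C B A).toMap (gwp3 γ⁻¹ β α)) = comm (comm c⁻¹ b) a ∧
      Fox.pull (kprod3.t132 A B C).toMap
          (Fox.image (smash3.proj A C B).toMap (gwp3 α⁻¹ γ β)) = comm (comm a⁻¹ c) b ∧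
      conj (Fox.pull (kprod3.t213 A B C).toMap
          (Fox.image (smash3.proj B A C).toMap (gwp3 β⁻¹ α γ))) b *
        conj (Fox.pull (kprod3.t321 A B C).toMap
          (Fox.image (smash3.proj C B A).toMap (gwp3 γ⁻¹ β α))) c *
        conj (Fox.pull (kprod3.t132 A B C).toMap
          (Fox.image (smash3.proj A C B).toMap (gwp3 α⁻¹ γ β))) a = 1) ∧
    (HasCGType A → HasCGType B → HasCGType C →
      (Susp.CoCommutative A → Susp.CoCommutative B → Susp.CoCommutative C →
        gwp3 α β γ *
          (gwp3 γ α β).pull (Susp.map (smash3.t312 A B C)) *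
          (gwp3 β γ α).pull (Susp.map (smash3.t231 A B C)) = 1) ∧
      ((Susp.CoCommutative A ∨ ∃ s : PMap S0.{u} A, IsHEquiv s) →
        (Susp.CoCommutative B ∨ ∃ s : PMap S0.{u} B, IsHEquiv s) →
        (Susp.CoCommutative C ∨ ∃ s : PMap S0.{u} C, IsHEquiv s) →
        (dot β (gwp3 β⁻¹ α γ)).pull (Susp.map (smash3.t213 A B C)) *
          (dot γ (gwp3 γ⁻¹ β α)).pull (Susp.map (smash3.t321 A B C)) *
          (dot α (gwp3 α⁻¹ γ β)).pull (Susp.map (smash3.t132 A B C)) = 1)) := by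
  refine ⟨⟨existsUnique_isGWP hA hB α β, fun κ => existsUnique_isGWP (hA.smash hB) hC κ γ,
    existsUnique_isAction (hA.smash3 hB hC)⟩, ?_, fun hA' hB' hC' =>
      ⟨fun hcA hcB hcC => gwp3_jacobi hA hB hC hA' hB' hC' hcA hcB hcC α β γ,
        fun hcA hcB hcC => dot_gwp3_jacobi hA hB hC hA' hB' hC' hcA hcB hcC α β γ⟩⟩
  rintro a b c rfl rfl rfl
  have h213 := Fox.pull_image_gwp3 (kprod3.t213 A B C).toMap hB hA hC β⁻¹ α γ
  have h321 := Fox.pull_image_gwp3 (kprod3.t321 A B C).toMap hC hB hA γ⁻¹ β α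
  have h132 := Fox.pull_image_gwp3 (kprod3.t132 A B C).toMap hA hC hB α⁻¹ γ β
  rw [Fox.image_inv] at h213 h321 h132
  refine ⟨h213, h321, h132, ?_⟩
  rw [h213, h321, h132]
  exact Fox.hall_witt _ _ _

open Jacobi in
theorem theorem3 (A B C : PSpace.{u}) (X : PSpace.{v})
    (hA : HasCGHType A) (hB : HasCGHType B) (hC : HasCGHType C)
    (α : HClass (Susp A) X) (β : HClass (Susp B) X) (γ : HClass (Susp C) X) :
    -- the products and the action in the statement are well defined
    ((∃! κ, IsGWP α β κ) ∧ (∀ κ : HClass (Susp (smash A B)) X, ∃! μ, IsGWP κ γ μ) ∧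
      (∀ (ω : HClass (Susp S0.{u}) X) (η : HClass (Susp (smash3 A B C)) X),
        ∃! θ, IsAction ω η θ)) ∧
    -- (1)
    (∀ a b c : Fox (kprod3 A B C) X,
      a = Fox.image (kprod3.p1 A B C).toMap α →
      b = Fox.image (kprod3.p2 A B C).toMap β →
      c = Fox.image (kprod3.p3 A B C).toMap γ →
      Fox.pull (kprod3.t213 A B C).toMap
          (Fox.image (smash3.proj B A C).toMap (gwp3 β⁻¹ α γ)) = comm (comm b⁻¹ a) c ∧
      Fox.pull (kprod3.t321 A B C).toMap
          (Fox.image (smash3.proj C B A).toMap (gwp3 γ⁻¹ β α)) = comm (comm c⁻¹ b) a ∧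
      Fox.pull (kprod3.t132 A B C).toMap
          (Fox.image (smash3.proj A C B).toMap (gwp3 α⁻¹ γ β)) = comm (comm a⁻¹ c) b ∧
      conj (Fox.pull (kprod3.t213 A B C).toMap
          (Fox.image (smash3.proj B A C).toMap (gwp3 β⁻¹ α γ))) b *
        conj (Fox.pull (kprod3.t321 A B C).toMap
          (Fox.image (smash3.proj C B A).toMap (gwp3 γ⁻¹ β α))) c *
        conj (Fox.pull (kprod3.t132 A B C).toMap
          (Fox.image (smash3.proj A C B).toMap (gwp3 α⁻¹ γ β))) a = 1) ∧
    -- (2)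
    (Susp.CoCommutative A → Susp.CoCommutative B → Susp.CoCommutative C →
      gwp3 α β γ *
        (gwp3 γ α β).pull (Susp.map (smash3.t312 A B C)) *
        (gwp3 β γ α).pull (Susp.map (smash3.t231 A B C)) = 1) ∧
    -- (3)
    ((Susp.CoCommutative A ∨ ∃ s : PMap S0.{u} A, IsHEquiv s) →
      (Susp.CoCommutative B ∨ ∃ s : PMap S0.{u} B, IsHEquiv s) →
      (Susp.CoCommutative C ∨ ∃ s : PMap S0.{u} C, IsHEquiv s) →
      (dot β (gwp3 β⁻¹ α γ)).pull (Susp.map (smash3.t213 A B C)) *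
        (dot γ (gwp3 γ⁻¹ β α)).pull (Susp.map (smash3.t321 A B C)) *
        (dot α (gwp3 α⁻¹ γ β)).pull (Susp.map (smash3.t132 A B C)) = 1) := by
  obtain ⟨h_unique, h_fox, h_smash⟩ := theorem3_general A B C X hA.hWellPointed hB.hWellPointed
    hC.hWellPointed α β γ
  exact ⟨h_unique, h_fox, h_smash hA.hasCGType hB.hasCGType hC.hasCGType⟩
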